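/- Let $k$ be a field. A finite-dimensional $k$-algebra $\Lambda$ is elementary if $\Lambda/\operatorname{rad}\Lambda$ is isomorphic, as a $k$-algebra, to a finite product of copies of $k$. Let $A$, $B$, $C$ be finite-dimensional elementary $k$-algebras, with $A$ of finite global dimension, and let $\{e_1,\dots,e_n\}$, $\{f_1,\dots,f_m\}$, $\{g_1,\dots,g_p\}$ be complete sets of orthogonal primitive idempotents of $A$, $B$, $C$ respectively (pairwise orthogonal primitive idempotents with sum $1$). Bimodules are $k$-central. For a finite-dimensional $B$-$A$-bimodule $X$, let $\operatorname{dm}X\in\mathbb Z^{n\times m}$ be the matrix with entries $(\operatorname{dm}X)_{ij}=\dim_k f_jXe_i$, and similarly for bimodules over other pairs of these algebras (the left algebra indexes the columns, the right algebra the rows). Let $C_A=\operatorname{dm}({}_AA_A)\in\mathbb Z^{n\times n}$, $(C_A)_{ij}=\dim_k e_jAe_i$, be the Cartan matrix of $A$. Then $C_A$ is invertible over $\mathbb Z$, and the following two statements hold. (1) For every finite-dimensional $B$-$A$-bimodule $M$ and every finite-dimensional $C$-$A$-bimodule $N$, the $C$-$B$-bimodules $\operatorname{Ext}_A^l(M,N)$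 of right $A$-modules are finite-dimensional for all $l\ge 0$, only finitely many of them are nonzero, and $$\sum_{l\ge 0}(-1)^l\operatorname{dm}\operatorname{Ext}_A^l(M,N)=(\operatorname{dm}M)^T\cdot C_A^{-T}\cdot\operatorname{dm}N\quad\text{in }\mathbb Z^{m\times p}.$$ (2) For every finite-dimensional $B$-$A$-bimodule $M$ and every finite-dimensional $A$-$C$-bimodule $N$, the $B$-$C$-bimodules $\operatorname{Tor}^A_l(M,N)$ are finite-dimensional for all $l\ge 0$, only finitely many of them are nonzero, and $$\sum_{l\ge 0}(-1)^l\operatorname{dm}\operatorname{Tor}^A_l(M,N)=\operatorname{dm}N\cdot C_A^{-1}\cdot\operatorname{dm}M\quad\text{in }\mathbb Z^{p\times m}.$$ -/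

import Mathlib

open CategoryTheory MulOpposite
open scoped TensorProduct

universe u w w₁ w₂

noncomputable section

namespace HRR

/-! ### Elementary algebras, idempotents, global dimension -/

/-- A `k`-algebra `A` is elementary if `A / rad A` is a finite product of copies of `k`. -/
def IsElementary (k : Type w) (A : Type w₁) [Field k] [Ring A] [Algebra k A] : Prop :=
  ∃ n : ℕ, Nonempty ((A ⧸ Ring.jacobson A) ≃ₐ[k] (Fin n → k))

/-- A nonzero idempotent that is not the sum of two nonzero orthogonal idempotents. -/
def IsPrimitiveIdempotent {A : Type w₁} [Ring A] (e : A) : Prop :=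
  IsIdempotentElem e ∧ e ≠ 0 ∧
    ∀ a b : A, IsIdempotentElem a → IsIdempotentElem b → a * b = 0 → b * a = 0 → e = a + b →
      a = 0 ∨ b = 0

/-- `e₁, …, eₙ` are primitive idempotents, pairwise orthogonal, with sum `1`. -/
structure IsCompletePrimitive {A : Type w₁} [Ring A] {n : ℕ} (e : Fin n → A) : Prop
    extends CompleteOrthogonalIdempotents e where
  primitive : ∀ i, IsPrimitiveIdempotent (e i)

/-- The projective dimensions of all right `A`-modules (modules over `Aᵐᵒᵖ`) are bounded. -/
def HasFiniteGlobalDimension (A : Type u) [Ring A] : Prop :=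
  ∃ d : ℕ, ∀ X : ModuleCat.{u} Aᵐᵒᵖ, HasProjectiveDimensionLE X d

/-! ### Dimension matrices

A `B`-`A`-bimodule over `k` is a type `M` with commuting actions of `B` and of `Aᵐᵒᵖ`, both of which
are compatible with one `k`-vector space structure on `M`. -/

section DimMatrix

variable (k : Type w) [Field k] {A : Type w₁} [Ring A] [Algebra k A]
  {B : Type w₂} [Ring B] [Algebra k B]

/-- The subspace `f M e` of the `B`-`A`-bimodule `M`: the image of `x ↦ f x e`. -/
def corner (e : A) (f : B) (M : Type*) [AddCommGroup M] [Module k M] [Module B M] [Module Aᵐᵒᵖ M]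
    [IsScalarTower k B M] [IsScalarTower k Aᵐᵒᵖ M] : Submodule k M :=
  LinearMap.range (Algebra.lsmul k k M f ∘ₗ Algebra.lsmul k k M (op e))

/-- The dimension matrix of a `B`-`A`-bimodule `M`; its `(i, j)` entry is `dim fⱼ M eᵢ`. -/
def dimMatrix {n m : ℕ} (e : Fin n → A) (f : Fin m → B) (M : Type*) [AddCommGroup M] [Module k M]
    [Module B M] [Module Aᵐᵒᵖ M] [IsScalarTower k B M] [IsScalarTower k Aᵐᵒᵖ M] :
    Matrix (Fin n) (Fin m) ℤ :=
  Matrix.of fun i j => (Module.finrank k (corner k (e i) (f j) M) : ℤ)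

/-- The Cartan matrix of `A`; its `(i, j)` entry is `dim eⱼ A eᵢ`. -/
def cartanMatrix {n : ℕ} (e : Fin n → A) : Matrix (Fin n) (Fin n) ℤ :=
  dimMatrix k e e A

/-- A graded vector space is finite-dimensional: finitely many of its components are nonzero, and
all of them have finite dimension. -/
def IsTotallyFinite (H : ℕ → Type*) [∀ l, AddCommGroup (H l)] [∀ l, Module k (H l)] : Prop :=
  (∀ l, FiniteDimensional k (H l)) ∧ {l | Nontrivial (H l)}.Finite

/-- The super-dimension matrix `∑ₗ (-1)ˡ dm Hₗ` of a graded `B`-`A`-bimodule. -/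
def superDimMatrix {n m : ℕ} (e : Fin n → A) (f : Fin m → B) (H : ℕ → Type*)
    [∀ l, AddCommGroup (H l)] [∀ l, Module k (H l)] [∀ l, Module B (H l)]
    [∀ l, Module Aᵐᵒᵖ (H l)] [∀ l, IsScalarTower k B (H l)]
    [∀ l, IsScalarTower k Aᵐᵒᵖ (H l)] : Matrix (Fin n) (Fin m) ℤ :=
  ∑ᶠ l : ℕ, (-1 : ℤ) ^ l • dimMatrix k e f (H l)

end DimMatrix

/-! ### `Ext` as a bimodule -/

section Actions

variable {R : Type w₁} [Ring R] {S : Type w₂} [Ring S]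

/-- If the action of `S` on an `R`-module `M` commutes with that of `R`, then `s : S` acts on `M` by
an endomorphism of `R`-modules. -/
def actHom (R : Type w₁) [Ring R] {S : Type w₂} [Ring S] (M : Type u) [AddCommGroup M] [Module R M]
    [Module S M] [SMulCommClass S R M] (s : S) : ModuleCat.of R M ⟶ ModuleCat.of R M :=
  ModuleCat.ofHom (Module.toModuleEnd R (S := S) M s)

variable (M : Type u) [AddCommGroup M] [Module R M] [Module S M] [SMulCommClass S R M]

@[simp]
lemma actHom_apply (s : S) (x : M) : (actHom R M s).hom x = s • x := rfl

lemma actHom_one : actHom R M (1 : S) = 𝟙 _ := by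
  ext x; exact one_smul S (x : M)

lemma actHom_zero : actHom R M (0 : S) = 0 := by
  ext x; exact zero_smul S (x : M)

lemma actHom_add (s t : S) : actHom R M (s + t) = actHom R M s + actHom R M t := by
  ext x; exact add_smul s t (x : M)

lemma actHom_mul (s t : S) : actHom R M (s * t) = actHom R M t ≫ actHom R M s := by
  ext x; exact mul_smul s t (x : M)

lemma actHom_smul {k : Type w} [Field k] [Algebra k R] [Algebra k S] (r : k) (s : S)
    (h : ∀ x : M, (r • s) • x = algebraMap k R r • s • x) :
    actHom R M (r • s) = r • actHom R M s := by
  ext x; exact h x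

end Actions

section Ext

variable (k : Type w) [Field k] (A : Type u) [Ring A] [Algebra k A]
  (B : Type w₁) [Ring B] [Algebra k B] (C : Type w₂) [Ring C] [Algebra k C]
  (M N : Type u)
  [AddCommGroup M] [Module k M] [Module Aᵐᵒᵖ M] [IsScalarTower k Aᵐᵒᵖ M]
  [AddCommGroup N] [Module k N] [Module Aᵐᵒᵖ N] [IsScalarTower k Aᵐᵒᵖ N] (l : ℕ)

/-- `C` acts on `Ext_A^l(M, N)` from the left, through the functoriality in `N`. -/
def extLeftAction [Module C N] [IsScalarTower k C N] [SMulCommClass C Aᵐᵒᵖ N] :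
    C →ₐ[k] Module.End k (Abelian.Ext (ModuleCat.of Aᵐᵒᵖ M) (ModuleCat.of Aᵐᵒᵖ N) l) :=
  AlgHom.mk'
    { toFun := fun c =>
        (Abelian.Ext.mk₀ (actHom Aᵐᵒᵖ N c)).postcompOfLinear k _ (add_zero l)
      map_one' := by ext x; simp [actHom_one]
      map_mul' := fun c d => by ext x; simp [actHom_mul]
      map_zero' := by ext x; simp [actHom_zero]
      map_add' := fun c d => by ext x; simp [actHom_add, Abelian.Ext.mk₀_add] }
    fun r c => by
      ext x
      simp [actHom_smul (R := Aᵐᵒᵖ) N r c (fun x => by rw [smul_assoc, algebraMap_smul]),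
        Abelian.Ext.mk₀_smul]

/-- `B` acts on `Ext_A^l(M, N)` from the right, through the functoriality in `M`. -/
def extRightAction [Module B M] [IsScalarTower k B M] [SMulCommClass B Aᵐᵒᵖ M] :
    Bᵐᵒᵖ →ₐ[k] Module.End k (Abelian.Ext (ModuleCat.of Aᵐᵒᵖ M) (ModuleCat.of Aᵐᵒᵖ N) l) :=
  AlgHom.mk'
    { toFun := fun b =>
        (Abelian.Ext.mk₀ (actHom Aᵐᵒᵖ M b.unop)).precompOfLinear k _ (zero_add l)
      map_one' := by ext x; simp [actHom_one]
      map_mul' := fun c d => by ext x; simp [actHom_mul]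
      map_zero' := by ext x; simp [actHom_zero]
      map_add' := fun c d => by ext x; simp [actHom_add, Abelian.Ext.mk₀_add] }
    fun r c => by
      ext x
      simp [actHom_smul (R := Aᵐᵒᵖ) M r c.unop (fun x => by rw [smul_assoc, algebraMap_smul]),
        Abelian.Ext.mk₀_smul]

/-- `Ext_A^l(M, N)` as a `C`-`B`-bimodule, for a `B`-`A`-bimodule `M` and a `C`-`A`-bimodule `N`.
The arguments `k`, `B` and `C` of this type only serve to tell the three actions apart. -/
@[nolint unusedArguments]
def ExtBimod (_k : Type w) (A : Type u) [Ring A] (_B : Type w₁) (_C : Type w₂)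
    (M N : Type u) [AddCommGroup M] [Module Aᵐᵒᵖ M] [AddCommGroup N] [Module Aᵐᵒᵖ N] (l : ℕ) :
    Type u :=
  Abelian.Ext (ModuleCat.of Aᵐᵒᵖ M) (ModuleCat.of Aᵐᵒᵖ N) l

instance : AddCommGroup (ExtBimod k A B C M N l) :=
  inferInstanceAs (AddCommGroup (Abelian.Ext (ModuleCat.of Aᵐᵒᵖ M) (ModuleCat.of Aᵐᵒᵖ N) l))

instance extModule : Module k (ExtBimod k A B C M N l) :=
  inferInstanceAs (Module k (Abelian.Ext (ModuleCat.of Aᵐᵒᵖ M) (ModuleCat.of Aᵐᵒᵖ N) l))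

instance extLeftModule [Module C N] [IsScalarTower k C N] [SMulCommClass C Aᵐᵒᵖ N] :
    Module C (ExtBimod k A B C M N l) :=
  Module.compHom (Abelian.Ext (ModuleCat.of Aᵐᵒᵖ M) (ModuleCat.of Aᵐᵒᵖ N) l)
    (extLeftAction k A C M N l).toRingHom

instance extRightModule [Module B M] [IsScalarTower k B M] [SMulCommClass B Aᵐᵒᵖ M] :
    Module Bᵐᵒᵖ (ExtBimod k A B C M N l) :=
  Module.compHom (Abelian.Ext (ModuleCat.of Aᵐᵒᵖ M) (ModuleCat.of Aᵐᵒᵖ N) l)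
    (extRightAction k A B M N l).toRingHom

instance [Module C N] [IsScalarTower k C N] [SMulCommClass C Aᵐᵒᵖ N] :
    IsScalarTower k C (ExtBimod k A B C M N l) where
  smul_assoc r c x := LinearMap.congr_fun (map_smul (extLeftAction k A C M N l) r c) x

instance [Module B M] [IsScalarTower k B M] [SMulCommClass B Aᵐᵒᵖ M] :
    IsScalarTower k Bᵐᵒᵖ (ExtBimod k A B C M N l) where
  smul_assoc r b x := LinearMap.congr_fun (map_smul (extRightAction k A B M N l) r b) x

instance [Module C N] [IsScalarTower k C N] [SMulCommClass C Aᵐᵒᵖ N]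
    [Module B M] [IsScalarTower k B M] [SMulCommClass B Aᵐᵒᵖ M] :
    SMulCommClass C Bᵐᵒᵖ (ExtBimod k A B C M N l) where
  smul_comm c b x :=
    Abelian.Ext.comp_assoc_of_third_deg_zero
      (Abelian.Ext.mk₀ (actHom Aᵐᵒᵖ M b.unop)) x (Abelian.Ext.mk₀ (actHom Aᵐᵒᵖ N c)) (zero_add l)

end Ext

/-! ### Tensor products over a noncommutative algebra -/

section Tensor

variable (k : Type w) [Field k] (A : Type w₁) [Ring A]

/-- The subspace of `M ⊗ₖ N` spanned by all `m a ⊗ n - m ⊗ a n`. -/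
def balancedRel (M N : Type*) [AddCommGroup M] [Module k M] [Module Aᵐᵒᵖ M] [AddCommGroup N]
    [Module k N] [Module A N] : Submodule k (M ⊗[k] N) :=
  Submodule.span k {z | ∃ (m : M) (a : A) (n : N), z = (op a • m) ⊗ₜ[k] n - m ⊗ₜ[k] (a • n)}

/-- `M ⊗_A N` for a right `A`-module `M` and a left `A`-module `N`. -/
abbrev BalancedTensor (M N : Type*) [AddCommGroup M] [Module k M] [Module Aᵐᵒᵖ M]
    [AddCommGroup N] [Module k N] [Module A N] : Type _ :=
  (M ⊗[k] N) ⧸ balancedRel k A M N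

lemma balanced_hom_ext {M N P : Type*} [AddCommGroup M] [Module k M] [Module Aᵐᵒᵖ M]
    [AddCommGroup N] [Module k N] [Module A N] [AddCommGroup P] [Module k P]
    {φ ψ : BalancedTensor k A M N →ₗ[k] P}
    (h : ∀ m n, φ (Submodule.Quotient.mk (m ⊗ₜ[k] n)) = ψ (Submodule.Quotient.mk (m ⊗ₜ[k] n))) :
    φ = ψ :=
  Submodule.linearMap_qext _ (TensorProduct.ext' h)

variable [Algebra k A] {M M' M'' N N' N'' : Type*}
  [AddCommGroup M] [Module k M] [Module Aᵐᵒᵖ M] [IsScalarTower k Aᵐᵒᵖ M]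
  [AddCommGroup M'] [Module k M'] [Module Aᵐᵒᵖ M'] [IsScalarTower k Aᵐᵒᵖ M']
  [AddCommGroup M''] [Module k M''] [Module Aᵐᵒᵖ M''] [IsScalarTower k Aᵐᵒᵖ M'']
  [AddCommGroup N] [Module k N] [Module A N] [IsScalarTower k A N]
  [AddCommGroup N'] [Module k N'] [Module A N'] [IsScalarTower k A N']
  [AddCommGroup N''] [Module k N''] [Module A N''] [IsScalarTower k A N'']

/-- `f ⊗_A g`. -/
def balancedMap (f : M →ₗ[Aᵐᵒᵖ] M') (g : N →ₗ[A] N') :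
    BalancedTensor k A M N →ₗ[k] BalancedTensor k A M' N' :=
  Submodule.mapQ _ _ (TensorProduct.map (f.restrictScalars k) (g.restrictScalars k)) <| by
    rw [balancedRel, Submodule.span_le]
    rintro _ ⟨m, a, n, rfl⟩
    refine Submodule.subset_span ⟨f m, a, g n, ?_⟩
    simp

@[simp]
lemma balancedMap_tmul (f : M →ₗ[Aᵐᵒᵖ] M') (g : N →ₗ[A] N') (m : M) (n : N) :
    balancedMap k A f g (Submodule.Quotient.mk (m ⊗ₜ[k] n)) =
      Submodule.Quotient.mk (f m ⊗ₜ[k] g n) := rfl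

lemma balancedMap_id :
    balancedMap k A (LinearMap.id : M →ₗ[Aᵐᵒᵖ] M) (LinearMap.id : N →ₗ[A] N) = LinearMap.id :=
  balanced_hom_ext k A fun _ _ => rfl

lemma balancedMap_comp (f : M →ₗ[Aᵐᵒᵖ] M') (f' : M' →ₗ[Aᵐᵒᵖ] M'') (g : N →ₗ[A] N')
    (g' : N' →ₗ[A] N'') :
    balancedMap k A (f' ∘ₗ f) (g' ∘ₗ g) = balancedMap k A f' g' ∘ₗ balancedMap k A f g :=
  balanced_hom_ext k A fun _ _ => rfl

lemma balancedMap_add_left (f f' : M →ₗ[Aᵐᵒᵖ] M') (g : N →ₗ[A] N') :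
    balancedMap k A (f + f') g = balancedMap k A f g + balancedMap k A f' g :=
  balanced_hom_ext k A fun m n => by
    simp [TensorProduct.add_tmul]

lemma balancedMap_add_right (f : M →ₗ[Aᵐᵒᵖ] M') (g g' : N →ₗ[A] N') :
    balancedMap k A f (g + g') = balancedMap k A f g + balancedMap k A f g' :=
  balanced_hom_ext k A fun m n => by
    simp [TensorProduct.tmul_add]

end Tensor

section TensorFunctor

open ModuleCat

variable (k : Type w) [Field k] (A : Type u) [Ring A] [Algebra k A]
  (N : Type u) [AddCommGroup N] [Module k N] [Module A N] [IsScalarTower k A N]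

/-- The functor `- ⊗_A N` from right `A`-modules to `k`-vector spaces. -/
def tensorFunctor : ModuleCat.{u} Aᵐᵒᵖ ⥤ ModuleCat.{u} k where
  obj X := ModuleCat.of k (BalancedTensor k A X N)
  map f := ModuleCat.ofHom (balancedMap k A f.hom (LinearMap.id : N →ₗ[A] N))
  map_id X := by
    rw [ModuleCat.hom_id, balancedMap_id]; rfl
  map_comp f g := by
    rw [ModuleCat.hom_comp, ← ModuleCat.ofHom_comp, ← balancedMap_comp, LinearMap.comp_id]

instance : (tensorFunctor k A N).Additive where
  map_add {X Y f g} := by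
    change ModuleCat.ofHom _ = _
    rw [ModuleCat.hom_add, balancedMap_add_left]; rfl

variable {N}

/-- The natural transformation `- ⊗_A g`. -/
def tensorNatTrans (g : N →ₗ[A] N) : tensorFunctor k A N ⟶ tensorFunctor k A N where
  app X := ModuleCat.ofHom (balancedMap k A (LinearMap.id : X →ₗ[Aᵐᵒᵖ] X) g)
  naturality X Y f := by
    change ModuleCat.ofHom _ ≫ ModuleCat.ofHom _ = ModuleCat.ofHom _ ≫ ModuleCat.ofHom _
    rw [← ModuleCat.ofHom_comp, ← ModuleCat.ofHom_comp, ← balancedMap_comp, ← balancedMap_comp]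

lemma tensorNatTrans_id : tensorNatTrans k A (LinearMap.id : N →ₗ[A] N) = 𝟙 _ :=
  NatTrans.ext (funext fun _ => ModuleCat.hom_ext (balancedMap_id k A))

lemma tensorNatTrans_comp (g h : N →ₗ[A] N) :
    tensorNatTrans k A (g ∘ₗ h) = tensorNatTrans k A h ≫ tensorNatTrans k A g :=
  NatTrans.ext (funext fun _ => ModuleCat.hom_ext
    (balancedMap_comp k A LinearMap.id LinearMap.id h g))

lemma tensorNatTrans_add (g g' h : N →ₗ[A] N) (e : h = g + g') (X : ModuleCat.{u} Aᵐᵒᵖ) :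
    (tensorNatTrans k A h).app X = (tensorNatTrans k A g).app X + (tensorNatTrans k A g').app X := by
  subst e
  exact ModuleCat.hom_ext (balancedMap_add_right k A _ g g')

lemma tensorNatTrans_smul (r : k) (g h : N →ₗ[A] N) (e : ∀ n, h n = r • g n)
    (X : ModuleCat.{u} Aᵐᵒᵖ) :
    (tensorNatTrans k A h).app X = r • (tensorNatTrans k A g).app X := by
  refine ModuleCat.hom_ext (balanced_hom_ext k A fun m n => ?_)
  change Submodule.Quotient.mk (m ⊗ₜ[k] h n) =
    r • (Submodule.Quotient.mk (m ⊗ₜ[k] g n) : BalancedTensor k A X N)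
  rw [← Submodule.Quotient.mk_smul, e, TensorProduct.tmul_smul]

end TensorFunctor

/-! ### `Tor` as a bimodule -/

section Derived

variable {R : Type*} [Ring R] {𝒞 : Type*} [Category* 𝒞] [Abelian 𝒞] [HasProjectiveResolutions 𝒞]
  {𝒟 : Type*} [Category* 𝒟] [Abelian 𝒟] [Linear R 𝒟] (F : 𝒞 ⥤ 𝒟) [F.Additive]

lemma leftDerived_map_add {X Y : 𝒞} (f g : X ⟶ Y) (l : ℕ) :
    (F.leftDerived l).map (f + g) = (F.leftDerived l).map f + (F.leftDerived l).map g := by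
  let P := projectiveResolution X
  let Q := projectiveResolution Y
  rw [F.leftDerived_map_eq l f (ProjectiveResolution.lift f P Q) (by simp),
    F.leftDerived_map_eq l g (ProjectiveResolution.lift g P Q) (by simp),
    F.leftDerived_map_eq l (f + g)
      (ProjectiveResolution.lift f P Q + ProjectiveResolution.lift g P Q) (by
        simp [Functor.map_add])]
  simp only [Functor.map_add, Preadditive.add_comp, Preadditive.comp_add]

lemma homologyMap_smul' {K L : ChainComplex 𝒟 ℕ} (r : R) (φ : K ⟶ L) (l : ℕ) :
    (HomologicalComplex.homologyFunctor 𝒟 _ l).map (r • φ) =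
      r • (HomologicalComplex.homologyFunctor 𝒟 _ l).map φ :=
  ShortComplex.homologyMap_smul
    ((HomologicalComplex.shortComplexFunctor 𝒟 (ComplexShape.down ℕ) l).map φ) r

lemma leftDerived_map_smul [Linear R 𝒞] [F.Linear R] {X Y : 𝒞} (r : R) (f : X ⟶ Y) (l : ℕ) :
    (F.leftDerived l).map (r • f) = r • (F.leftDerived l).map f := by
  let P := projectiveResolution X
  let Q := projectiveResolution Y
  rw [F.leftDerived_map_eq l f (ProjectiveResolution.lift f P Q) (by simp),
    F.leftDerived_map_eq l (r • f) (r • ProjectiveResolution.lift f P Q) (by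
        rw [Linear.smul_comp, ProjectiveResolution.lift_commutes]
        ext
        simp only [HomologicalComplex.smul_f_apply, HomologicalComplex.comp_f,
          ChainComplex.single₀_map_f_zero]
        exact (Linear.comp_smul _ _ _ (P.π.f 0) r f).symm)]
  rw [Functor.comp_map, Functor.map_smul, homologyMap_smul', Linear.smul_comp, Linear.comp_smul]
  rfl

variable {F}

lemma leftDerived_app_add (α β γ : F ⟶ F) (X : 𝒞) (l : ℕ)
    (h : ∀ Y, γ.app Y = α.app Y + β.app Y) :
    (NatTrans.leftDerived γ l).app X =
      (NatTrans.leftDerived α l).app X + (NatTrans.leftDerived β l).app X := by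
  let P := projectiveResolution X
  have e : (NatTrans.mapHomologicalComplex γ (ComplexShape.down ℕ)).app P.complex =
      (NatTrans.mapHomologicalComplex α _).app P.complex +
        (NatTrans.mapHomologicalComplex β _).app P.complex := by
    ext i
    exact h _
  simp only [P.leftDerived_app_eq, e, Functor.map_add, Preadditive.add_comp, Preadditive.comp_add]

lemma leftDerived_app_smul (r : R) (α γ : F ⟶ F) (X : 𝒞) (l : ℕ)
    (h : ∀ Y, γ.app Y = r • α.app Y) :
    (NatTrans.leftDerived γ l).app X = r • (NatTrans.leftDerived α l).app X := by
  let P := projectiveResolution X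
  have e : (NatTrans.mapHomologicalComplex γ (ComplexShape.down ℕ)).app P.complex =
      r • (NatTrans.mapHomologicalComplex α _).app P.complex := by
    ext i
    exact h _
  simp only [P.leftDerived_app_eq, e, homologyMap_smul', Linear.smul_comp, Linear.comp_smul]

end Derived

section Tor

variable (k : Type w) [Field k] (A : Type u) [Ring A] [Algebra k A]
  (B : Type w₁) [Ring B] [Algebra k B] (C : Type w₂) [Ring C] [Algebra k C]
  (M : Type u) [AddCommGroup M] [Module k M] [Module Aᵐᵒᵖ M] [IsScalarTower k Aᵐᵒᵖ M]
  (N : Type u) [AddCommGroup N] [Module k N] [Module A N] [IsScalarTower k A N] (l : ℕ)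

open ModuleCat in
instance : (tensorFunctor k A N).Linear k where
  map_smul {X Y} f r := by
    refine ModuleCat.hom_ext (balanced_hom_ext k A fun m n => ?_)
    change Submodule.Quotient.mk ((r • f.hom m) ⊗ₜ[k] n) =
      r • (Submodule.Quotient.mk (f.hom m ⊗ₜ[k] n) : BalancedTensor k A Y N)
    rw [← Submodule.Quotient.mk_smul, TensorProduct.smul_tmul']

/-- `Tor_l^A(M, N)`: the value at `M` of the `l`-th left derived functor of `- ⊗_A N`. -/
abbrev torObj : ModuleCat.{u} k :=
  ((tensorFunctor k A N).leftDerived l).obj (ModuleCat.of Aᵐᵒᵖ M)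

/-- `B` acts on `Tor_l^A(M, N)` from the left, through the functoriality in `M`. -/
def torLeftAction [Module B M] [IsScalarTower k B M] [SMulCommClass B Aᵐᵒᵖ M] :
    B →ₐ[k] Module.End k (torObj k A M N l) :=
  AlgHom.mk'
    { toFun := fun b => (((tensorFunctor k A N).leftDerived l).map (actHom Aᵐᵒᵖ M b)).hom
      map_one' := by rw [actHom_one, CategoryTheory.Functor.map_id]; rfl
      map_mul' := fun b c => by rw [actHom_mul, Functor.map_comp]; rfl
      map_zero' := by
        have h := leftDerived_map_add (tensorFunctor k A N)
          (0 : ModuleCat.of Aᵐᵒᵖ M ⟶ ModuleCat.of Aᵐᵒᵖ M) 0 l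
        rw [add_zero, left_eq_add] at h
        rw [actHom_zero, h]; rfl
      map_add' := fun b c => by rw [actHom_add, leftDerived_map_add]; rfl }
    fun r b => by
      have h := actHom_smul (R := Aᵐᵒᵖ) M r b (fun x => by rw [smul_assoc, algebraMap_smul])
      change (((tensorFunctor k A N).leftDerived l).map (actHom Aᵐᵒᵖ M (r • b))).hom = _
      rw [h, leftDerived_map_smul]
      rfl

/-- `C` acts on `Tor_l^A(M, N)` from the right, through the functoriality in `N`. -/
def torRightAction [Module Cᵐᵒᵖ N] [IsScalarTower k Cᵐᵒᵖ N] [SMulCommClass A Cᵐᵒᵖ N] :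
    Cᵐᵒᵖ →ₐ[k] Module.End k (torObj k A M N l) :=
  haveI := SMulCommClass.symm A Cᵐᵒᵖ N
  AlgHom.mk'
    { toFun := fun c => ((NatTrans.leftDerived
          (tensorNatTrans k A (Module.toModuleEnd A (S := Cᵐᵒᵖ) N c)) l).app
          (ModuleCat.of Aᵐᵒᵖ M)).hom
      map_one' := by
        rw [map_one, Module.End.one_eq_id, tensorNatTrans_id, NatTrans.leftDerived_id]; rfl
      map_mul' := fun c d => by
        rw [map_mul, Module.End.mul_eq_comp, tensorNatTrans_comp, NatTrans.leftDerived_comp]; rfl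
      map_zero' := by
        have h := leftDerived_app_add
          (tensorNatTrans k A (Module.toModuleEnd A (S := Cᵐᵒᵖ) N 0))
          (tensorNatTrans k A (Module.toModuleEnd A (S := Cᵐᵒᵖ) N 0))
          (tensorNatTrans k A (Module.toModuleEnd A (S := Cᵐᵒᵖ) N 0)) (ModuleCat.of Aᵐᵒᵖ M) l
          (tensorNatTrans_add k A _ _ _ (by rw [map_zero, add_zero]))
        rw [left_eq_add] at h
        rw [h]; rfl
      map_add' := fun c d => by
        rw [leftDerived_app_add _ _ _ (ModuleCat.of Aᵐᵒᵖ M) l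
          (tensorNatTrans_add k A (Module.toModuleEnd A (S := Cᵐᵒᵖ) N c)
            (Module.toModuleEnd A (S := Cᵐᵒᵖ) N d) _ (map_add _ c d))]
        rfl }
    fun r c => by
      have h := leftDerived_app_smul r
        (tensorNatTrans k A (Module.toModuleEnd A (S := Cᵐᵒᵖ) N c))
        (tensorNatTrans k A (Module.toModuleEnd A (S := Cᵐᵒᵖ) N (r • c))) (ModuleCat.of Aᵐᵒᵖ M) l
        (tensorNatTrans_smul k A r _ _ fun n => smul_assoc r c n)
      exact congrArg ModuleCat.Hom.hom h

/-- `Tor_l^A(M, N)` as a `B`-`C`-bimodule, for a `B`-`A`-bimodule `M` and an `A`-`C`-bimodule `N`.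
The arguments `B` and `C` of this type only serve to tell the actions apart. -/
@[nolint unusedArguments]
def TorBimod (k : Type w) [Field k] (A : Type u) [Ring A] [Algebra k A] (_B : Type w₁)
    (_C : Type w₂) (M : Type u) [AddCommGroup M] [Module Aᵐᵒᵖ M]
    (N : Type u) [AddCommGroup N] [Module k N] [Module A N] [IsScalarTower k A N] (l : ℕ) :
    Type u :=
  torObj k A M N l

instance : AddCommGroup (TorBimod k A B C M N l) :=
  inferInstanceAs (AddCommGroup (torObj k A M N l))

instance torModule : Module k (TorBimod k A B C M N l) :=
  inferInstanceAs (Module k (torObj k A M N l))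

instance torLeftModule [Module B M] [IsScalarTower k B M] [SMulCommClass B Aᵐᵒᵖ M] :
    Module B (TorBimod k A B C M N l) :=
  Module.compHom (torObj k A M N l) (torLeftAction k A B M N l).toRingHom

instance torRightModule [Module Cᵐᵒᵖ N] [IsScalarTower k Cᵐᵒᵖ N] [SMulCommClass A Cᵐᵒᵖ N] :
    Module Cᵐᵒᵖ (TorBimod k A B C M N l) :=
  Module.compHom (torObj k A M N l) (torRightAction k A C M N l).toRingHom

instance [Module B M] [IsScalarTower k B M] [SMulCommClass B Aᵐᵒᵖ M] :
    IsScalarTower k B (TorBimod k A B C M N l) where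
  smul_assoc r b x := LinearMap.congr_fun (map_smul (torLeftAction k A B M N l) r b) x

instance [Module Cᵐᵒᵖ N] [IsScalarTower k Cᵐᵒᵖ N] [SMulCommClass A Cᵐᵒᵖ N] :
    IsScalarTower k Cᵐᵒᵖ (TorBimod k A B C M N l) where
  smul_assoc r c x := LinearMap.congr_fun (map_smul (torRightAction k A C M N l) r c) x

instance [Module B M] [IsScalarTower k B M] [SMulCommClass B Aᵐᵒᵖ M]
    [Module Cᵐᵒᵖ N] [IsScalarTower k Cᵐᵒᵖ N] [SMulCommClass A Cᵐᵒᵖ N] :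
    SMulCommClass B Cᵐᵒᵖ (TorBimod k A B C M N l) where
  smul_comm b c x :=
    haveI := SMulCommClass.symm A Cᵐᵒᵖ N
    (LinearMap.congr_fun (congrArg ModuleCat.Hom.hom ((NatTrans.leftDerived (tensorNatTrans k A
      (Module.toModuleEnd A (S := Cᵐᵒᵖ) N c)) l).naturality (actHom Aᵐᵒᵖ M b))) x).symm

end Tor

end HRR

end

/-! Work with left modules over `R = Aᵐᵒᵖ` and put `χ(X, Y) = ∑ (-1)ˡ dim Extˡ(X, Y)`. If all
projective dimensions are at most `d`, only the degrees `l ≤ d` contribute, and the long exact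
sequences make `χ` additive in both variables (`extEuler_additive_left`, `extEuler_additive_right`).

As `A` is elementary, each `eᵢ` determines a character `cᵢ : A → k` with `cᵢ(eⱼ) = δᵢⱼ`
(`exists_characters`). The one-dimensional modules `Sᵢ` of these characters are all the simple
modules, and `Sᵢ` occurs `dim εᵢX` times as a composition factor of `X`, where `εᵢ = op eᵢ`.
Dévissage (`additive_eq_sum_peirceDim`) therefore gives `χ(X, Y) = ∑ dim(εᵢX) Eᵢⱼ dim(εⱼY)` with
`Eᵢⱼ = χ(Sᵢ, Sⱼ)`. For the projective module `X = Rεᵢ` and `Y = Sⱼ` the left side is `dim Hom(Rεᵢ,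
Sⱼ) = dim εᵢSⱼ = δᵢⱼ`, while the composition factors of `Rεᵢ` are counted by the Cartan matrix.
Hence `C_Aᵀ E = 1`, which shows at once that `C_A` is invertible and that `E = C_A⁻ᵀ`
(`extEuler_eq_sum`).

The bimodule formulas follow entry by entry. Idempotents split, so `g Ext(M, N) f = Ext(fM, gN)` and
`f Tor(M, N) g = Tor(fM, Ng)` (`finrank_corner_extBimod`, `finrank_corner_torBimod`). The case of
`Tor` reduces to that of `Ext` by the duality `Extˡ(X, DN) ≅ D Torₗ(X, N)`, where `D` is the
`k`-dual (`nonempty_ext_equiv_dual_tor`). -/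

noncomputable section

namespace HRR

/-! ### Characters of an elementary algebra. -/

section Characters

variable {k : Type w} [Field k] {A : Type w₁} [Ring A] [Algebra k A] [FiniteDimensional k A]

/-- An elementary algebra has, for each member of a complete set of primitive orthogonal
idempotents, exactly one character that does not vanish on it; an element that is killed by all
characters is nilpotent. -/
lemma exists_characters (hA : IsElementary k A) {n : ℕ} {e : Fin n → A}
    (he : IsCompletePrimitive e) :
    ∃ c : Fin n → (A →ₐ[k] k), (∀ i j, c i (e j) = if i = j then 1 else 0) ∧
      ∀ x : A, (∀ i, c i x = 0) → IsNilpotent x := by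
  obtain ⟨N, ⟨φ⟩⟩ := hA
  have : IsArtinianRing A := isArtinian_of_tower k inferInstance
  let q : A →ₐ[k] (Fin N → k) := φ.toAlgHom.comp (Ideal.Quotient.mkₐ k (Ring.jacobson A))
  have hq : Function.Surjective q := φ.surjective.comp Ideal.Quotient.mk_surjective
  have hnil : ∀ x, q x = 0 → IsNilpotent x := by
    intro x hx
    have hx' : x ∈ Ring.jacobson A := by
      have : Ideal.Quotient.mk (Ring.jacobson A) x = 0 := φ.injective (by simpa [q] using hx)
      exact Ideal.Quotient.eq_zero_iff_mem.mp this
    obtain ⟨m, hm⟩ := IsSemiprimaryRing.isNilpotent (R := A)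
    refine ⟨m, ?_⟩
    have := Ideal.pow_mem_pow hx' m
    rw [hm] at this
    simpa using this
  have h01 : ∀ t i, q (e i) t = 0 ∨ q (e i) t = 1 := fun t i => by
    have := congrFun (congrArg q (he.idem i).eq) t
    rw [map_mul, Pi.mul_apply] at this
    exact IsIdempotentElem.iff_eq_zero_or_one.mp this
  -- A nonzero idempotent is not nilpotent, so it survives modulo the radical.
  have hex : ∀ i, ∃ t, q (e i) t = 1 := by
    intro i
    by_contra! h
    have h0 : q (e i) = 0 := funext fun t => (h01 t i).resolve_right (h t)
    obtain ⟨m, hm⟩ := hnil _ h0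
    cases m with
    | zero =>
      rw [pow_zero] at hm
      exact (he.primitive i).2.1 (by rw [← mul_one (e i), hm, mul_zero])
    | succ m =>
      rw [(he.idem i).pow_succ_eq] at hm
      exact (he.primitive i).2.1 hm
  have huniq : ∀ i t s, q (e i) t = 1 → q (e i) s = 1 → t = s := by
    intro i t s ht hs
    by_contra hts
    -- Lift the `t`-th coordinate idempotent through the nil kernel of `q`, orthogonally to `1 - e
    -- i`. The lift `a` then lies in `e i * A * e i`, and `e i = a + (e i - a)` contradicts
    -- primitivity: `a` is nonzero at coordinate `t`, `e i - a` at coordinate `s`.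
    obtain ⟨a, ha, hqa, ha1, ha2⟩ :=
      exists_isIdempotentElem_mul_eq_zero_of_ker_isNilpotent (q : A →+* (Fin N → k))
        (fun x hx => hnil x hx) (Pi.single t 1) ((q : A →+* (Fin N → k)).mem_range.mpr (hq _))
        (by rw [IsIdempotentElem, ← Pi.single_mul, one_mul]) (1 - e i) (he.idem i).one_sub
        (by
          ext r
          by_cases hr : r = t
          · subst hr; simp [ht]
          · simp [hr])
        (by
          ext r
          by_cases hr : r = t
          · subst hr; simp [ht]
          · simp [hr])
    have ha1' : a * e i = a := by rw [mul_sub, mul_one, sub_eq_zero] at ha1; exact ha1.symm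
    have ha2' : e i * a = a := by rw [sub_mul, one_mul, sub_eq_zero] at ha2; exact ha2.symm
    have hqa' : q a = Pi.single t 1 := hqa
    rcases (he.primitive i).2.2 a (e i - a) ha
      (by rw [IsIdempotentElem, mul_sub, sub_mul, sub_mul, (he.idem i).eq, ha1', ha2', ha.eq]; simp)
      (by rw [mul_sub, ha1', ha.eq, sub_self]) (by rw [sub_mul, ha2', ha.eq, sub_self]) (by simp)
      with h | h
    · rw [h, map_zero] at hqa'
      simpa using congrFun hqa' t
    · have := congrArg q h
      rw [map_sub, map_zero, hqa'] at this
      simpa [hs, Ne.symm hts] using congrFun this s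
  choose t ht using hex
  have hort : ∀ i j, q (e j) (t i) = if i = j then 1 else 0 := by
    intro i j
    split_ifs with hij
    · rw [← hij, ht]
    · have := congrFun (congrArg q (he.ortho hij)) (t i)
      simpa [ht] using this
  refine ⟨fun i => (Pi.evalAlgHom k (fun _ : Fin N => k) (t i)).comp q, hort, fun x hx => ?_⟩
  refine hnil x (funext fun s => ?_)
  -- The `e i` sum to `1`, so every coordinate of `Fin N → k` is one of the `t i`. Vanishing of all
  -- `c i x` thus means `q x = 0`.
  obtain ⟨i, hi⟩ : ∃ i, q (e i) s = 1 := by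
    by_contra! h
    have h1 := congrFun (congrArg q he.complete) s
    rw [map_sum, map_one, Finset.sum_apply,
      Finset.sum_eq_zero fun i _ => (h01 s i).resolve_right (h i)] at h1
    simp at h1
  rw [huniq i s (t i) hi (ht i)]
  exact hx i

end Characters

/-! ### Euler characteristics of long exact sequences. -/

section EulerCharacteristic

variable {k : Type w} [Field k]

/-- Here `r l` plays the rank of the connecting map from degree `l` to degree `l + 1`. It enters two
consecutive degrees with opposite signs, so up to degree `d` only the term `(-1) ^ d * r d` remains.
-/
lemma alternating_sum_telescope {a b c r : ℕ → ℤ} (h₀ : b 0 + r 0 = a 0 + c 0)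
    (h : ∀ l, b (l + 1) + r l + r (l + 1) = a (l + 1) + c (l + 1)) {d : ℕ} (hd : r d = 0) :
    ∑ l ∈ Finset.range (d + 1), (-1) ^ l * b l =
      ∑ l ∈ Finset.range (d + 1), (-1) ^ l * a l + ∑ l ∈ Finset.range (d + 1), (-1) ^ l * c l := by
  have key : ∀ d, ∑ l ∈ Finset.range (d + 1), (-1) ^ l * b l + (-1) ^ d * r d =
      ∑ l ∈ Finset.range (d + 1), (-1) ^ l * a l +
        ∑ l ∈ Finset.range (d + 1), (-1) ^ l * c l := by
    intro d
    induction d with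
    | zero => simpa using h₀
    | succ d ih =>
      rw [Finset.sum_range_succ, Finset.sum_range_succ (fun l => (-1) ^ l * a l),
        Finset.sum_range_succ (fun l => (-1) ^ l * c l)]
      linear_combination ih + (-1) ^ (d + 1) * h d
  simpa [hd] using key d

/-- The alternating sum of dimensions is additive on a long exact sequence
`0 → A⁰ → B⁰ → C⁰ → A¹ → ⋯` with `Aᵈ⁺¹ = 0`. -/
lemma alternating_sum_longExact {A B C : ℕ → Type*} [∀ l, AddCommGroup (A l)]
    [∀ l, AddCommGroup (B l)] [∀ l, AddCommGroup (C l)] [∀ l, Module k (A l)]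
    [∀ l, Module k (B l)] [∀ l, Module k (C l)] [∀ l, FiniteDimensional k (A l)]
    [∀ l, FiniteDimensional k (B l)] [∀ l, FiniteDimensional k (C l)]
    (f : ∀ l, A l →ₗ[k] B l) (g : ∀ l, B l →ₗ[k] C l) (δ : ∀ l, C l →ₗ[k] A (l + 1))
    (hf : Function.Injective (f 0)) (hfg : ∀ l, Function.Exact (f l) (g l))
    (hgδ : ∀ l, Function.Exact (g l) (δ l)) (hδf : ∀ l, Function.Exact (δ l) (f (l + 1)))
    {d : ℕ} (hd : Subsingleton (A (d + 1))) :
    ∑ l ∈ Finset.range (d + 1), (-1) ^ l * (Module.finrank k (B l) : ℤ) =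
      ∑ l ∈ Finset.range (d + 1), (-1) ^ l * (Module.finrank k (A l) : ℤ) +
        ∑ l ∈ Finset.range (d + 1), (-1) ^ l * (Module.finrank k (C l) : ℤ) := by
  -- Rank-nullity for the three maps in degree `l`. The kernel of `f l` is zero for `l = 0` and
  -- otherwise the range of the preceding connecting map.
  have key : ∀ l, Module.finrank k (B l) + Module.finrank k (LinearMap.ker (f l)) +
      Module.finrank k (LinearMap.range (δ l)) =
        Module.finrank k (A l) + Module.finrank k (C l) := fun l => by
    have h₁ := (f l).finrank_range_add_finrank_ker
    have h₂ := (g l).finrank_range_add_finrank_ker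
    have h₃ := (δ l).finrank_range_add_finrank_ker
    rw [(hfg l).linearMap_ker_eq] at h₂
    rw [(hgδ l).linearMap_ker_eq] at h₃
    omega
  refine alternating_sum_telescope (r := fun l => Module.finrank k (LinearMap.range (δ l)))
    ?_ (fun l => ?_) ?_
  · have := key 0
    rw [LinearMap.ker_eq_bot.mpr hf, finrank_bot, add_zero] at this
    exact_mod_cast this
  · have := key (l + 1)
    rw [(hδf l).linearMap_ker_eq] at this
    exact_mod_cast this
  · have : LinearMap.range (δ d) = ⊥ := Submodule.eq_bot_of_subsingleton
    simp [this]

end EulerCharacteristic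

/-! ### The Euler form of `Ext` and its additivity. -/

section ExtEuler

open Abelian ModuleCat

variable (k : Type w) [Field k] {R : Type u} [Ring R] [Algebra k R]

lemma finiteDimensional_of_finite [FiniteDimensional k R] (X : ModuleCat.{u} R)
    [Module.Finite R X] : FiniteDimensional k X :=
  Module.Finite.trans R X

/-- Restriction of scalars as a linear map on spaces of homomorphisms. -/
def homRestrict (X Y : ModuleCat.{u} R) : (X ⟶ Y) →ₗ[k] (X →ₗ[k] Y) where
  toFun f := f.hom.restrictScalars k
  map_add' _ _ := rfl
  map_smul' _ _ := rfl

lemma homRestrict_injective (X Y : ModuleCat.{u} R) :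
    Function.Injective (homRestrict k X Y) := fun _ _ h =>
  ModuleCat.hom_ext (LinearMap.ext fun x => LinearMap.congr_fun h x)

/-- The alternating sum of the dimensions of `Ext X Y l` for `l < D`. -/
def extEuler (D : ℕ) (X Y : ModuleCat.{u} R) : ℤ :=
  ∑ l ∈ Finset.range D, (-1) ^ l * (Module.finrank k (Ext X Y l) : ℤ)

lemma extEuler_projective (P Y : ModuleCat.{u} R) [Projective P] (d : ℕ) :
    extEuler k (d + 1) P Y = Module.finrank k (P ⟶ Y) := by
  rw [extEuler, Finset.sum_range_succ', Finset.sum_eq_zero fun l _ => ?_]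
  · simp [(Ext.linearEquiv₀ (R := k) (X := P) (Y := Y)).finrank_eq]
  · have : Subsingleton (Ext P Y (l + 1)) := Ext.subsingleton_of_projective P Y l
    rw [Module.finrank_zero_of_subsingleton, Nat.cast_zero, mul_zero]

variable [FiniteDimensional k R]

/-- Dimension shifting: if `K` is the kernel of a surjection from a finite free module onto `X`,
then `Ext X Y (l + 1)` is a quotient of `Ext K Y l`. -/
lemma finiteDimensional_ext (X Y : ModuleCat.{u} R) [Module.Finite R X] [Module.Finite R Y]
    (l : ℕ) : FiniteDimensional k (Ext X Y l) := by
  have : IsNoetherianRing R := isNoetherian_of_tower k inferInstance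
  induction l generalizing X with
  | zero =>
    have := finiteDimensional_of_finite k X
    have := finiteDimensional_of_finite k Y
    have : FiniteDimensional k (X ⟶ Y) :=
      Module.Finite.of_injective (homRestrict k X Y) (homRestrict_injective k X Y)
    exact Module.Finite.equiv (Ext.linearEquiv₀ (R := k)).symm
  | succ l ih =>
    obtain ⟨m, f, hf⟩ := Module.Finite.exists_fin' R X
    let exac := LinearMap.shortExact_shortComplexKer hf
    have := ih f.shortComplexKer.X₁
    exact Module.Finite.of_surjective (exac.extClass.precompOfLinear k Y (add_comm 1 l))
      (precomp_extClass_surjective_of_projective_X₂ Y exac l)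

lemma extEuler_additive_left {d : ℕ} {S : ShortComplex (ModuleCat.{u} R)} (hS : S.ShortExact)
    [Module.Finite R S.X₂] (Y : ModuleCat.{u} R) [Module.Finite R Y]
    (hd : HasProjectiveDimensionLT S.X₃ (d + 1)) :
    extEuler k (d + 1) S.X₂ Y = extEuler k (d + 1) S.X₁ Y + extEuler k (d + 1) S.X₃ Y := by
  have : IsNoetherianRing R := isNoetherian_of_tower k inferInstance
  have : Module.Finite R S.X₁ := Module.Finite.of_injective S.f.hom hS.moduleCat_injective_f
  have : Module.Finite R S.X₃ := Module.Finite.of_surjective S.g.hom hS.moduleCat_surjective_g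
  have := hS.epi_g
  have := finiteDimensional_ext k S.X₁ Y
  have := finiteDimensional_ext k S.X₂ Y
  have := finiteDimensional_ext k S.X₃ Y
  -- The contravariant sequence starts with `Ext S.X₃ Y` and ends each degree with `Ext S.X₁ Y`.
  rw [add_comm (extEuler k (d + 1) S.X₁ Y)]
  refine alternating_sum_longExact (k := k)
    (fun l => (Ext.mk₀ S.g).precompOfLinear k Y (zero_add l))
    (fun l => (Ext.mk₀ S.f).precompOfLinear k Y (zero_add l))
    (fun l => hS.extClass.precompOfLinear k Y (add_comm 1 l))
    (Ext.precomp_mk₀_injective_of_epi Y S.g)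
    (fun l => LinearMap.exact_iff.mpr (le_antisymm ?_ ?_))
    (fun l => LinearMap.exact_iff.mpr (le_antisymm ?_ ?_))
    (fun l => LinearMap.exact_iff.mpr (le_antisymm ?_ ?_))
    (HasProjectiveDimensionLT.subsingleton S.X₃ (d + 1) (d + 1) le_rfl Y)
  · exact fun x hx => Ext.contravariant_sequence_exact₂ hS Y x hx
  · rintro _ ⟨x, rfl⟩
    simp [← Ext.comp_assoc_of_second_deg_zero]
  · exact fun x hx => Ext.contravariant_sequence_exact₁ hS Y x (add_comm 1 l) hx
  · rintro _ ⟨x, rfl⟩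
    simp
  · exact fun x hx => Ext.contravariant_sequence_exact₃ hS Y x hx (add_comm 1 l)
  · rintro _ ⟨x, rfl⟩
    simp

lemma extEuler_additive_right {d : ℕ} {S : ShortComplex (ModuleCat.{u} R)} (hS : S.ShortExact)
    [Module.Finite R S.X₂] (X : ModuleCat.{u} R) [Module.Finite R X]
    (hd : HasProjectiveDimensionLT X (d + 1)) :
    extEuler k (d + 1) X S.X₂ = extEuler k (d + 1) X S.X₁ + extEuler k (d + 1) X S.X₃ := by
  have : IsNoetherianRing R := isNoetherian_of_tower k inferInstance
  have : Module.Finite R S.X₁ := Module.Finite.of_injective S.f.hom hS.moduleCat_injective_f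
  have : Module.Finite R S.X₃ := Module.Finite.of_surjective S.g.hom hS.moduleCat_surjective_g
  have := hS.mono_f
  have := finiteDimensional_ext k X S.X₁
  have := finiteDimensional_ext k X S.X₂
  have := finiteDimensional_ext k X S.X₃
  refine alternating_sum_longExact (k := k)
    (fun l => (Ext.mk₀ S.f).postcompOfLinear k X (add_zero l))
    (fun l => (Ext.mk₀ S.g).postcompOfLinear k X (add_zero l))
    (fun l => hS.extClass.postcompOfLinear k X rfl)
    (Ext.postcomp_mk₀_injective_of_mono X S.f)
    (fun l => LinearMap.exact_iff.mpr (le_antisymm ?_ ?_))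
    (fun l => LinearMap.exact_iff.mpr (le_antisymm ?_ ?_))
    (fun l => LinearMap.exact_iff.mpr (le_antisymm ?_ ?_))
    (HasProjectiveDimensionLT.subsingleton X (d + 1) (d + 1) le_rfl S.X₁)
  · exact fun x hx => Ext.covariant_sequence_exact₂ X hS x hx
  · rintro _ ⟨x, rfl⟩
    simp
  · exact fun x hx => Ext.covariant_sequence_exact₃ X hS x rfl hx
  · rintro _ ⟨x, rfl⟩
    simp
  · exact fun x hx => Ext.covariant_sequence_exact₁ X hS x hx rfl
  · rintro _ ⟨x, rfl⟩
    simp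

end ExtEuler

/-! ### Dimensions of the spaces `εX`. -/

section PeirceDim

open ModuleCat

variable (k : Type w) [Field k] {R : Type u} [Ring R] [Algebra k R]

/-- The dimension of `ε X`. -/
def peirceDim (ε : R) (X : Type*) [AddCommGroup X] [Module k X] [Module R X]
    [IsScalarTower k R X] : ℕ :=
  Module.finrank k (LinearMap.range (Algebra.lsmul k k X ε))

variable {ε : R}

/-- The tower conditions force `R`-linear maps to be `k`-linear. The `k`-structures are plain
implicit arguments, so that `g = LinearEquiv.refl` compares two `k`-structures given on the same
module. -/
lemma peirceDim_congr {X Y : Type*} [AddCommGroup X] {_ : Module k X} [Module R X]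
    {_ : IsScalarTower k R X} [AddCommGroup Y] {_ : Module k Y} [Module R Y]
    {_ : IsScalarTower k R Y}
    (g : X ≃ₗ[R] Y) (ε : R) : peirceDim k ε X = peirceDim k ε Y := by
  have h : LinearMap.range (Algebra.lsmul k k Y ε) =
      (LinearMap.range (Algebra.lsmul k k X ε)).map (g.restrictScalars k).toLinearMap := by
    apply le_antisymm
    · rintro _ ⟨y, rfl⟩
      exact ⟨ε • g.symm y, ⟨g.symm y, rfl⟩, by simp⟩
    · rintro _ ⟨_, ⟨x, rfl⟩, rfl⟩
      exact ⟨g x, by simp⟩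
  rw [peirceDim, peirceDim, h]
  exact ((g.restrictScalars k).submoduleMap _).finrank_eq

lemma projective_span_idempotent (hε : IsIdempotentElem ε) :
    Module.Projective R (Ideal.span {ε}) := by
  refine Module.Projective.of_split (Ideal.span {ε}).subtype
    ((LinearMap.toSpanSingleton R R ε).codRestrict (Ideal.span {ε}) fun r =>
      Ideal.mul_mem_left _ r (Ideal.mem_span_singleton_self ε)) ?_
  ext ⟨x, hx⟩
  obtain ⟨r, rfl⟩ := Ideal.mem_span_singleton'.mp hx
  change (r * ε) * ε = r * ε
  rw [mul_assoc, hε.eq]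

/-- A homomorphism from `Rε` is determined by the image of `ε`, and the possible images are exactly
the elements of `εX`. -/
lemma finrank_hom_span_idempotent (hε : IsIdempotentElem ε) (X : ModuleCat.{u} R) :
    Module.finrank k (ModuleCat.of R (Ideal.span {ε}) ⟶ X) = peirceDim k ε X := by
  let gen : Ideal.span {ε} := ⟨ε, Ideal.mem_span_singleton_self ε⟩
  let ev : (ModuleCat.of R (Ideal.span {ε}) ⟶ X) →ₗ[k] X :=
    { toFun := fun f => f.hom gen
      map_add' := fun _ _ => rfl
      map_smul' := fun _ _ => rfl }
  have hgen : ∀ r : R, ∀ h : r * ε ∈ Ideal.span {ε},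
      (⟨r * ε, h⟩ : Ideal.span {ε}) = r • gen := fun _ _ => rfl
  have hinj : Function.Injective ev := by
    intro f g hfg
    ext ⟨x, hx⟩
    obtain ⟨r, rfl⟩ := Ideal.mem_span_singleton'.mp hx
    rw [hgen, map_smul, map_smul]
    exact congrArg (r • ·) hfg
  have hrange : LinearMap.range ev = LinearMap.range (Algebra.lsmul k k X ε) := by
    apply le_antisymm
    · rintro _ ⟨f, rfl⟩
      refine ⟨f.hom gen, ?_⟩
      change ε • f.hom gen = f.hom gen
      rw [← map_smul]
      exact congrArg f.hom (Subtype.ext hε.eq)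
    · rintro _ ⟨x, rfl⟩
      exact ⟨ModuleCat.ofHom ((LinearMap.toSpanSingleton R X x).comp (Ideal.span {ε}).subtype), rfl⟩
  rw [peirceDim, ← hrange, LinearMap.finrank_range_of_inj hinj]

/-- `Rε` is projective, so `dim εX` is the Euler form of `Rε` and `X` truncated to degree `0`;
additivity is a case of `extEuler_additive_right`. -/
lemma peirceDim_additive [FiniteDimensional k R] (hε : IsIdempotentElem ε)
    {S : ShortComplex (ModuleCat.{u} R)}
    (hS : S.ShortExact) [Module.Finite R S.X₂] :
    (peirceDim k ε S.X₂ : ℤ) = peirceDim k ε S.X₁ + peirceDim k ε S.X₃ := by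
  have := projective_span_idempotent hε
  have : IsNoetherianRing R := isNoetherian_of_tower k inferInstance
  have := extEuler_additive_right k hS (ModuleCat.of R (Ideal.span {ε})) (d := 0) inferInstance
  simpa only [extEuler_projective, finrank_hom_span_idempotent k hε] using this

variable {k} in
lemma peirceDim_of_character (c : R →ₐ[k] k) {X : Type*} [AddCommGroup X]
    [Module k X] [Module R X] [IsScalarTower k R X] (hX : ∀ (r : R) (x : X), r • x = c r • x)
    (h1 : Module.finrank k X = 1) {ε : R} {p : Prop} [Decidable p]
    (hc : c ε = if p then 1 else 0) : peirceDim k ε X = if p then 1 else 0 := by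
  have : Algebra.lsmul k k X ε = c ε • LinearMap.id := by
    ext x; simp [hX]
  split_ifs at hc ⊢ with hp
  · rw [peirceDim, this, hc, one_smul, LinearMap.range_id, finrank_top, h1]
  · rw [peirceDim, this, hc, zero_smul, LinearMap.range_zero, finrank_bot]

end PeirceDim

/-! ### Simple modules and dévissage. -/

section Simple

variable {k : Type w} [Field k] {R : Type u} [Ring R] [Algebra k R]

/-- The quotient of `R` by the kernel of a character, a simple left module. -/
def characterModule (c : R →ₐ[k] k) : Type u :=
  R ⧸ (RingHom.ker c : Submodule R R)

instance (c : R →ₐ[k] k) : AddCommGroup (characterModule c) :=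
  inferInstanceAs (AddCommGroup (R ⧸ (RingHom.ker c : Submodule R R)))

instance (c : R →ₐ[k] k) : Module R (characterModule c) :=
  inferInstanceAs (Module R (R ⧸ (RingHom.ker c : Submodule R R)))

instance (c : R →ₐ[k] k) : Module k (characterModule c) :=
  Module.restrictScalars k R (characterModule c)

instance (c : R →ₐ[k] k) : IsScalarTower k R (characterModule c) :=
  IsScalarTower.restrictScalars k R (characterModule c)

instance (c : R →ₐ[k] k) : Module.Finite R (characterModule c) :=
  inferInstanceAs (Module.Finite R (R ⧸ (RingHom.ker c : Submodule R R)))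

lemma characterModule_smul (c : R →ₐ[k] k) (r : R) (x : characterModule c) :
    r • x = c r • x := by
  rw [← algebraMap_smul R (c r) x]
  obtain ⟨y, rfl⟩ := Submodule.Quotient.mk_surjective _ x
  refine (Submodule.Quotient.eq (RingHom.ker c : Submodule R R)).mpr ?_
  simp [RingHom.mem_ker]

lemma finrank_characterModule (c : R →ₐ[k] k) : Module.finrank k (characterModule c) = 1 := by
  let v : characterModule c := (Submodule.Quotient.mk 1 : R ⧸ (RingHom.ker c : Submodule R R))
  have h1 : v ≠ 0 := fun h => by
    have := (Submodule.Quotient.mk_eq_zero (RingHom.ker c : Submodule R R)).mp h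
    simp [RingHom.mem_ker] at this
  refine (finrank_eq_one_iff_of_nonzero' _ h1).mpr fun x => ?_
  obtain ⟨y, rfl⟩ := Submodule.Quotient.mk_surjective _ x
  refine ⟨c y, ?_⟩
  rw [← characterModule_smul]
  exact congrArg _ (mul_one y)

variable {n : ℕ} {ε : Fin n → R} {c : Fin n → (R →ₐ[k] k)}

/-- If `x • s ≠ 0`, simplicity gives `r` with `(r * x) • s = s`. But `r * x` is killed by all
characters too, hence nilpotent, which forces `s = 0`. -/
lemma smul_eq_zero_of_forall_character
    (hnil : ∀ x : R, (∀ i, c i x = 0) → IsNilpotent x) (S : Type*) [AddCommGroup S] [Module R S]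
    [IsSimpleModule R S] {x : R} (hx : ∀ i, c i x = 0) (s : S) : x • s = 0 := by
  by_contra h
  obtain ⟨r, hr⟩ := IsSimpleModule.toSpanSingleton_surjective R h s
  rw [LinearMap.toSpanSingleton_apply, ← mul_smul] at hr
  obtain ⟨m, hm⟩ := hnil (r * x) fun i => by rw [map_mul, hx, mul_zero]
  have : ∀ m : ℕ, (r * x) ^ m • s = s := fun m => by
    induction m with
    | zero => simp
    | succ m ih => rw [pow_succ, mul_smul, hr, ih]
  have hs := this m
  rw [hm, zero_smul] at hs
  exact h (by rw [← hs, smul_zero])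

/-- A simple module is isomorphic to the quotient module of one of the characters. -/
lemma exists_characterModule_equiv (hone : ∑ i, ε i = 1)
    (hc : ∀ i j, c i (ε j) = if i = j then 1 else 0)
    (hnil : ∀ x : R, (∀ i, c i x = 0) → IsNilpotent x) (S : Type*) [AddCommGroup S] [Module R S]
    [IsSimpleModule R S] : ∃ i, Nonempty (characterModule (c i) ≃ₗ[R] S) := by
  have := IsSimpleModule.nontrivial R S
  obtain ⟨s, hs⟩ := exists_ne (0 : S)
  obtain ⟨i, hi⟩ : ∃ i, ε i • s ≠ 0 := by
    by_contra! h
    apply hs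
    rw [← one_smul R s, ← hone, Finset.sum_smul, Finset.sum_eq_zero fun i _ => h i]
  -- All characters vanish on `(r - c i r) * ε i`: `c i` kills the first factor and the others kill
  -- `ε i`. So `ε i • s` spans a line on which `R` acts through `c i`.
  have hsmul : ∀ r : R, r • ε i • s = algebraMap k R (c i r) • ε i • s := fun r => by
    rw [← sub_eq_zero, ← sub_smul, ← mul_smul]
    refine smul_eq_zero_of_forall_character hnil S (fun j => ?_) s
    rw [map_mul, map_sub, hc j i, AlgHom.commutes]
    split_ifs with h
    · simp [h]
    · simp
  refine ⟨i, ⟨(Submodule.quotEquivOfEq _ _ ?_).trans (LinearMap.quotKerEquivOfSurjective _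
    (IsSimpleModule.toSpanSingleton_surjective R hi))⟩⟩
  ext r
  rw [LinearMap.mem_ker, LinearMap.toSpanSingleton_apply, hsmul, RingHom.mem_ker]
  refine ⟨fun h => by rw [h, map_zero, zero_smul], fun h => ?_⟩
  by_contra h0
  apply hi
  rw [← one_smul R (ε i • s), ← map_one (algebraMap k R), ← inv_mul_cancel₀ h0, map_mul, mul_smul,
    h, smul_zero]

end Simple

section Devissage

open ModuleCat

variable {k : Type w} [Field k] {R : Type u} [Ring R] [Algebra k R] [FiniteDimensional k R]
  {n : ℕ} {ε : Fin n → R} {c : Fin n → (R →ₐ[k] k)}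

/-- An additive function on finite modules is determined by its values at simple modules. -/
lemma additive_eq_sum_peirceDim (hε : CompleteOrthogonalIdempotents ε)
    (hc : ∀ i j, c i (ε j) = if i = j then 1 else 0)
    (hnil : ∀ x : R, (∀ i, c i x = 0) → IsNilpotent x) {φ : ModuleCat.{u} R → ℤ}
    (hφ : ∀ S : ShortComplex (ModuleCat.{u} R), S.ShortExact → Module.Finite R S.X₂ →
      φ S.X₂ = φ S.X₁ + φ S.X₃) (X : ModuleCat.{u} R) [Module.Finite R X] :
    φ X = ∑ i, (peirceDim k (ε i) X : ℤ) * φ (ModuleCat.of R (characterModule (c i))) := by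
  have : IsNoetherianRing R := isNoetherian_of_tower k inferInstance
  have : IsArtinianRing R := isArtinian_of_tower k inferInstance
  -- For a zero module `Z` the sequence `0 → Z → Z → Z → 0` is exact and gives `φ Z = φ Z + φ Z`.
  have hzero : ∀ Z : ModuleCat.{u} R, Subsingleton Z → φ Z = 0 := fun Z hZ => by
    have h0 : Limits.IsZero Z := ModuleCat.isZero_of_subsingleton Z
    have := hφ (ShortComplex.mk (0 : Z ⟶ Z) (0 : Z ⟶ Z) (by simp))
      { exact := ShortComplex.exact_of_isZero_X₂ _ h0
        mono_f := ⟨fun _ _ _ => h0.eq_of_tgt _ _⟩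
        epi_g := ⟨fun _ _ _ => h0.eq_of_src _ _⟩ } inferInstance
    simpa using this
  -- Isomorphism invariance is not assumed of `φ`; it follows from additivity, since the kernel of
  -- an isomorphism is a zero module.
  have hiso : ∀ {Y Z : Type u} [AddCommGroup Y] [AddCommGroup Z] [Module R Y] [Module R Z]
      [Module.Finite R Y], (Y ≃ₗ[R] Z) → φ (ModuleCat.of R Y) = φ (ModuleCat.of R Z) := by
    intro Y Z _ _ _ _ _ g
    have := hφ _ (LinearMap.shortExact_shortComplexKer (f := g.toLinearMap) g.surjective)
      (by assumption)
    have h0 : Subsingleton (LinearMap.ker g.toLinearMap) := by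
      rw [LinearEquiv.ker]; infer_instance
    rw [hzero (ModuleCat.of R (LinearMap.ker g.toLinearMap)) h0, zero_add] at this
    exact this
  induction hd : ∑ j, peirceDim k (ε j) X using Nat.strong_induction_on generalizing X with
  | _ d ih =>
  rcases subsingleton_or_nontrivial X with hX | hX
  · rw [hzero X hX, Finset.sum_eq_zero fun i _ => ?_]
    rw [peirceDim, Module.finrank_zero_of_subsingleton]
    simp
  · obtain ⟨T, hT⟩ := IsAtomic.exists_atom (Submodule R X)
    have hses := LinearMap.shortExact_shortComplexKer T.mkQ_surjective
    have hK : IsAtom (LinearMap.ker T.mkQ) := by rwa [T.ker_mkQ]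
    have : IsSimpleModule R (LinearMap.ker T.mkQ) := isSimpleModule_iff_isAtom.mpr hK
    obtain ⟨i, ⟨g⟩⟩ := exists_characterModule_equiv hε.complete hc hnil (LinearMap.ker T.mkQ)
    have h2 : ∀ j, (peirceDim k (ε j) X : ℤ) = (if i = j then 1 else 0) +
        peirceDim k (ε j) (ModuleCat.of R (X ⧸ T)) := fun j => by
      have hg : peirceDim k (ε j) T.mkQ.shortComplexKer.X₁ =
          peirceDim k (ε j) (ModuleCat.of R (characterModule (c i))) :=
        peirceDim_congr k g.symm (ε j)
      rw [peirceDim_additive k (hε.idem j) hses, hg,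
        peirceDim_of_character (c i) (characterModule_smul (c i)) (finrank_characterModule (c i))
          (hc i j), Nat.cast_ite, Nat.cast_one, Nat.cast_zero]
    -- Dividing out a simple submodule lowers the total of the Peirce dimensions by exactly one.
    have hlt : ∑ j, peirceDim k (ε j) (ModuleCat.of R (X ⧸ T)) < d := by
      rw [← hd]
      zify
      simp_rw [h2, Finset.sum_add_distrib]
      simp
    rw [hφ _ hses inferInstance, ih _ hlt (ModuleCat.of R (X ⧸ T)) rfl, ← hiso g]
    simp_rw [h2, add_mul, Finset.sum_add_distrib]
    simp

end Devissage

/-! ### The Euler form in terms of the Cartan matrix. -/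

section CartanForm

open ModuleCat

variable {k : Type w} [Field k] {R : Type u} [Ring R] [Algebra k R] [FiniteDimensional k R]
  {n : ℕ} {ε : Fin n → R} {c : Fin n → (R →ₐ[k] k)}

/-- The Euler form of `Ext` is given by the inverse of the Cartan matrix. -/
lemma extEuler_eq_sum (hε : CompleteOrthogonalIdempotents ε)
    (hc : ∀ i j, c i (ε j) = if i = j then 1 else 0)
    (hnil : ∀ x : R, (∀ i, c i x = 0) → IsNilpotent x) {d : ℕ}
    (hd : ∀ X : ModuleCat.{u} R, HasProjectiveDimensionLE X d) (K : Matrix (Fin n) (Fin n) ℤ)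
    (hK : ∀ i j, K i j = peirceDim k (ε i) (Ideal.span {ε j})) :
    IsUnit K ∧ ∀ (X Y : Type u) [AddCommGroup X] [AddCommGroup Y] [Module k X] [Module k Y]
      [Module R X] [Module R Y] [IsScalarTower k R X] [IsScalarTower k R Y]
      [Module.Finite R X] [Module.Finite R Y],
      extEuler k (d + 1) (ModuleCat.of R X) (ModuleCat.of R Y) =
        ∑ i, ∑ j, (peirceDim k (ε i) X : ℤ) * K⁻¹ j i * peirceDim k (ε j) Y := by
  have hNoeth : IsNoetherianRing R := isNoetherian_of_tower k inferInstance
  let S (i : Fin n) : ModuleCat.{u} R := ModuleCat.of R (characterModule (c i))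
  have hSfin : ∀ i, Module.Finite R (S i) := fun i =>
    inferInstanceAs (Module.Finite R (characterModule (c i)))
  let E : Matrix (Fin n) (Fin n) ℤ := Matrix.of fun i j => extEuler k (d + 1) (S i) (S j)
  have hleft : ∀ X Y : ModuleCat.{u} R, Module.Finite R X → Module.Finite R Y →
      extEuler k (d + 1) X Y = ∑ i, (peirceDim k (ε i) X : ℤ) * extEuler k (d + 1) (S i) Y :=
    fun X Y _ _ => additive_eq_sum_peirceDim (φ := fun X => extEuler k (d + 1) X Y) hε hc hnil
      (fun T hT _ => extEuler_additive_left k hT Y (hd _)) X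
  have hright : ∀ X Y : ModuleCat.{u} R, Module.Finite R X → Module.Finite R Y →
      extEuler k (d + 1) X Y = ∑ i, (peirceDim k (ε i) Y : ℤ) * extEuler k (d + 1) X (S i) :=
    fun X Y _ _ => additive_eq_sum_peirceDim (φ := fun Y => extEuler k (d + 1) X Y) hε hc hnil
      (fun T hT _ => extEuler_additive_right k hT X (hd _)) Y
  have hKE : K.transpose * E = 1 := by
    ext i j
    have := projective_span_idempotent (hε.idem i)
    -- By projectivity the left side is `dim εᵢSⱼ = δᵢⱼ`; on the right, the multiplicities of the
    -- simple factors of `Rεᵢ` are the `i`-th column of `K`.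
    have h := hleft (ModuleCat.of R (Ideal.span {ε i})) (S j) inferInstance inferInstance
    rw [extEuler_projective, finrank_hom_span_idempotent k (hε.idem i),
      show peirceDim k (ε i) (S j) = _ from peirceDim_of_character (c j)
        (characterModule_smul (c j)) (finrank_characterModule (c j)) (hc j i)] at h
    rw [Matrix.mul_apply, Matrix.one_apply]
    simp only [Matrix.transpose_apply, hK, E, Matrix.of_apply]
    refine (Finset.sum_congr rfl fun a _ => ?_).trans (h.symm.trans (by simp [eq_comm]))
    exact congrArg (fun x : ℕ => (x : ℤ) * _)
      (peirceDim_congr k (LinearEquiv.refl R (Ideal.span {ε i})) (ε a))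
  have hunit : IsUnit K :=
    (Matrix.isUnit_transpose (A := K)).mp (IsUnit.of_mul_eq_one _ hKE)
  have hE : ∀ i j, E i j = K⁻¹ j i := fun i j => by
    rw [← Matrix.inv_eq_right_inv hKE, ← Matrix.transpose_nonsing_inv, Matrix.transpose_apply]
  refine ⟨hunit, fun X Y _ _ _ _ _ _ _ _ _ _ => ?_⟩
  rw [hleft (ModuleCat.of R X) (ModuleCat.of R Y) inferInstance inferInstance]
  refine Finset.sum_congr rfl fun i _ => ?_
  rw [hright _ (ModuleCat.of R Y) inferInstance inferInstance, Finset.mul_sum]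
  refine Finset.sum_congr rfl fun j _ => ?_
  rw [← hE i j, mul_assoc, mul_comm (E i j)]
  exact congrArg₂ (fun x y : ℕ => (x : ℤ) * ((y : ℤ) * _))
    (peirceDim_congr k (LinearEquiv.refl R X) (ε i))
    (peirceDim_congr k (LinearEquiv.refl R Y) (ε j))

end CartanForm

/-! ### Corners of bimodules and of `Ext`. -/

section Corner

variable (k : Type w) [Field k]

lemma finrank_range_comp_comp {V V' : Type*} [AddCommGroup V] [Module k V] [AddCommGroup V']
    [Module k V'] {ι : V' →ₗ[k] V} {π : V →ₗ[k] V'} (T : V' →ₗ[k] V')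
    (hι : Function.Injective ι) (hπ : Function.Surjective π) :
    Module.finrank k (LinearMap.range (ι ∘ₗ T ∘ₗ π)) = Module.finrank k (LinearMap.range T) := by
  rw [LinearMap.range_comp, LinearMap.range_comp_of_range_eq_top _ (LinearMap.range_eq_top.mpr hπ)]
  exact (Submodule.equivMapOfInjective ι hι _).symm.finrank_eq

variable {A : Type w₁} [Ring A] [Algebra k A]

/-- The left ideal of `Aᵐᵒᵖ` generated by `op (e j)` is the right ideal `eⱼA`, on which `op (e i)`
acts as right multiplication by `eᵢ`. -/
lemma cartanMatrix_apply {n : ℕ} (e : Fin n → A) (i j : Fin n) :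
    cartanMatrix k e i j = peirceDim k (op (e i)) (Ideal.span {op (e j)}) := by
  let ι : Ideal.span {op (e j)} →ₗ[k] A :=
    (MulOpposite.opLinearEquiv k).symm.toLinearMap ∘ₗ
      (Ideal.span {op (e j)}).subtype.restrictScalars k
  let π : A →ₗ[k] Ideal.span {op (e j)} :=
    { toFun := fun a => ⟨op a * op (e j), Ideal.mul_mem_left _ _ (Ideal.mem_span_singleton_self _)⟩
      map_add' := fun a b => Subtype.ext (by simp [add_mul])
      map_smul' := fun r a => Subtype.ext (by simp) }
  have hι : Function.Injective ι := fun x y h => Subtype.ext (unop_injective h)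
  have hπ : Function.Surjective π := by
    rintro ⟨x, hx⟩
    obtain ⟨r, rfl⟩ := Ideal.mem_span_singleton'.mp hx
    exact ⟨unop r, rfl⟩
  have h : Algebra.lsmul k k A (e j) ∘ₗ Algebra.lsmul k k A (op (e i)) =
      ι ∘ₗ Algebra.lsmul k k (Ideal.span {op (e j)}) (op (e i)) ∘ₗ π := by
    ext a
    simp [ι, π, mul_assoc]
  rw [peirceDim, ← finrank_range_comp_comp k _ hι hπ, ← h]
  rfl

end Corner

section PeirceSummand

variable (R : Type w₁) [Ring R] {S : Type w₂} [Ring S] (s : S)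
  (M : Type u) [AddCommGroup M] [Module R M] [Module S M] [SMulCommClass S R M]

/-- The `R`-submodule `s M` of `M`, for `s : S` acting by `R`-linear maps. -/
abbrev peirceSummand : Submodule R M :=
  LinearMap.range (Module.toModuleEnd R (S := S) M s)

/-- The projection of `M` onto `s M`. -/
abbrev peirceProj : M →ₗ[R] peirceSummand R s M :=
  (Module.toModuleEnd R (S := S) M s).rangeRestrict

/-- The inclusion of `s M` into `M`. -/
abbrev peirceIncl : peirceSummand R s M →ₗ[R] M :=
  (peirceSummand R s M).subtype

lemma peirceIncl_comp_peirceProj :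
    peirceIncl R s M ∘ₗ peirceProj R s M = Module.toModuleEnd R (S := S) M s := rfl

variable {s}

lemma peirceProj_comp_peirceIncl (hs : IsIdempotentElem s) :
    peirceProj R s M ∘ₗ peirceIncl R s M = LinearMap.id := by
  ext ⟨_, x, rfl⟩
  change s • s • x = s • x
  rw [← mul_smul, hs.eq]

end PeirceSummand

section DimMatrix

variable (k : Type w) [Field k] {A : Type w₁} [Ring A] [Algebra k A]
  {B : Type w₂} [Ring B] [Algebra k B]

lemma finrank_corner_eq_peirceDim_right (e : A) (f : B) (M : Type u) [AddCommGroup M] [Module k M]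
    [Module B M] [Module Aᵐᵒᵖ M] [IsScalarTower k B M] [IsScalarTower k Aᵐᵒᵖ M]
    [SMulCommClass B Aᵐᵒᵖ M] :
    Module.finrank k (corner k e f M) = peirceDim k (op e) (peirceSummand Aᵐᵒᵖ f M) := by
  have h : Algebra.lsmul k k M f ∘ₗ Algebra.lsmul k k M (op e) =
      (peirceIncl Aᵐᵒᵖ f M).restrictScalars k ∘ₗ
        Algebra.lsmul k k (peirceSummand Aᵐᵒᵖ f M) (op e) ∘ₗ
          (peirceProj Aᵐᵒᵖ f M).restrictScalars k := by
    ext x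
    exact smul_comm f (op e) x
  rw [corner, h]
  exact finrank_range_comp_comp k _ Subtype.val_injective (LinearMap.surjective_rangeRestrict _)

lemma finrank_corner_eq_peirceDim_left (e : A) (f : B) (M : Type u) [AddCommGroup M] [Module k M]
    [Module B M] [Module Aᵐᵒᵖ M] [IsScalarTower k B M] [IsScalarTower k Aᵐᵒᵖ M]
    [SMulCommClass Aᵐᵒᵖ B M] :
    Module.finrank k (corner k e f M) = peirceDim k f (peirceSummand B (op e) M) := by
  have h : Algebra.lsmul k k M f ∘ₗ Algebra.lsmul k k M (op e) =
      (peirceIncl B (op e) M).restrictScalars k ∘ₗ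
        Algebra.lsmul k k (peirceSummand B (op e) M) f ∘ₗ
          (peirceProj B (op e) M).restrictScalars k := rfl
  rw [corner, h]
  exact finrank_range_comp_comp k _ Subtype.val_injective (LinearMap.surjective_rangeRestrict _)

end DimMatrix

section ExtCorner

variable (k : Type w) [Field k] (A : Type u) [Ring A] [Algebra k A]
  (B : Type w₁) [Ring B] [Algebra k B] (C : Type w₂) [Ring C] [Algebra k C]
  (M N : Type u)
  [AddCommGroup M] [Module k M] [Module Aᵐᵒᵖ M] [IsScalarTower k Aᵐᵒᵖ M]
  [AddCommGroup N] [Module k N] [Module Aᵐᵒᵖ N] [IsScalarTower k Aᵐᵒᵖ N] (l : ℕ)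
  [Module B M] [IsScalarTower k B M] [SMulCommClass B Aᵐᵒᵖ M]
  [Module C N] [IsScalarTower k C N] [SMulCommClass C Aᵐᵒᵖ N]

open Abelian

/-- `fM` and `gN` are retracts of `M` and `N`, so functoriality makes `Ext(fM, gN)` a retract of
`Ext(M, N)`. The composite `ι ∘ π` of projection and inclusion is the operator `x ↦ g x f` that cuts
out the corner. -/
lemma finrank_corner_extBimod {f : B} {g : C} (hf : IsIdempotentElem f)
    (hg : IsIdempotentElem g) :
    Module.finrank k (corner k f g (ExtBimod k A B C M N l)) =
      Module.finrank k (Ext (ModuleCat.of Aᵐᵒᵖ (peirceSummand Aᵐᵒᵖ f M))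
        (ModuleCat.of Aᵐᵒᵖ (peirceSummand Aᵐᵒᵖ g N)) l) := by
  let iM := ModuleCat.ofHom (peirceIncl Aᵐᵒᵖ f M)
  let pM := ModuleCat.ofHom (peirceProj Aᵐᵒᵖ f M)
  let iN := ModuleCat.ofHom (peirceIncl Aᵐᵒᵖ g N)
  let pN := ModuleCat.ofHom (peirceProj Aᵐᵒᵖ g N)
  have hM : iM ≫ pM = 𝟙 _ := ModuleCat.hom_ext (peirceProj_comp_peirceIncl Aᵐᵒᵖ M hf)
  have hN : iN ≫ pN = 𝟙 _ := ModuleCat.hom_ext (peirceProj_comp_peirceIncl Aᵐᵒᵖ N hg)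
  let ι := (Ext.mk₀ iN).postcompOfLinear k (ModuleCat.of Aᵐᵒᵖ M) (add_zero l) ∘ₗ
    (Ext.mk₀ pM).precompOfLinear k (ModuleCat.of Aᵐᵒᵖ (peirceSummand Aᵐᵒᵖ g N)) (zero_add l)
  let π := (Ext.mk₀ iM).precompOfLinear k (ModuleCat.of Aᵐᵒᵖ (peirceSummand Aᵐᵒᵖ g N))
    (zero_add l) ∘ₗ (Ext.mk₀ pN).postcompOfLinear k (ModuleCat.of Aᵐᵒᵖ M) (add_zero l)
  have hπι : π ∘ₗ ι = LinearMap.id := by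
    ext x
    simp [π, ι, hM, hN]
  have hιπ : Algebra.lsmul k k (ExtBimod k A B C M N l) g ∘ₗ
      Algebra.lsmul k k (ExtBimod k A B C M N l) (op f) = ι ∘ₗ LinearMap.id ∘ₗ π := by
    refine LinearMap.ext fun (x : Ext (ModuleCat.of Aᵐᵒᵖ M) (ModuleCat.of Aᵐᵒᵖ N) l) => ?_
    change ((Ext.mk₀ (pM ≫ iM)).comp x (zero_add l)).comp (Ext.mk₀ (pN ≫ iN)) (add_zero l) =
      ((Ext.mk₀ pM).comp ((Ext.mk₀ iM).comp (x.comp (Ext.mk₀ pN) (add_zero l)) (zero_add l))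
        (zero_add l)).comp (Ext.mk₀ iN) (add_zero l)
    simp
  rw [corner, hιπ]
  refine (finrank_range_comp_comp k LinearMap.id
    (LinearMap.injective_of_comp_eq_id _ _ hπι)
    (LinearMap.surjective_of_comp_eq_id _ _ hπι)).trans ?_
  rw [LinearMap.range_id, finrank_top]

end ExtCorner

/-! ### The dual of homology over a field. -/

section DualHomology

variable {k : Type w} [Field k] (S : ShortComplex (ModuleCat.{u} k))

/-- The functionals on the middle term of a short complex that vanish on boundaries. -/
def dualCocycles : Submodule k (S.X₂ →ₗ[k] k) :=
  LinearMap.ker S.f.hom.dualMap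

/-- The map from functionals vanishing on boundaries to functionals on homology. -/
def dualCocyclesToDual :
    dualCocycles S →ₗ[k]
      Module.Dual k (LinearMap.ker S.g.hom ⧸ LinearMap.range S.moduleCatToCycles) where
  toFun φ := Submodule.liftQ _ (φ.1 ∘ₗ (LinearMap.ker S.g.hom).subtype) <| by
    rintro _ ⟨x, rfl⟩
    exact LinearMap.congr_fun φ.2 x
  map_add' φ ψ := Submodule.linearMap_qext _ rfl
  map_smul' r φ := Submodule.linearMap_qext _ rfl

/-- Over a field, a functional on the cycles extends to the whole middle term. -/
lemma dualCocyclesToDual_surjective : Function.Surjective (dualCocyclesToDual S) := by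
  intro χ
  obtain ⟨φ, hφ⟩ := LinearMap.exists_extend (χ ∘ₗ (LinearMap.range S.moduleCatToCycles).mkQ)
  refine ⟨⟨φ, ?_⟩, Submodule.linearMap_qext _ hφ⟩
  ext x
  have h := LinearMap.congr_fun hφ (S.moduleCatToCycles x)
  refine h.trans ?_
  have h0 : (LinearMap.range S.moduleCatToCycles).mkQ (S.moduleCatToCycles x) = 0 :=
    (Submodule.Quotient.mk_eq_zero _).mpr (LinearMap.mem_range_self _ x)
  rw [LinearMap.comp_apply, h0, map_zero]
  rfl

lemma dualCocyclesToDual_eq_zero_iff (φ : dualCocycles S) :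
    dualCocyclesToDual S φ = 0 ↔ ∃ ψ : Module.Dual k S.X₃, ψ ∘ₗ S.g.hom = φ.1 := by
  have h1 : dualCocyclesToDual S φ = 0 ↔ φ.1 ∈ (LinearMap.ker S.g.hom).dualAnnihilator := by
    rw [Submodule.mem_dualAnnihilator]
    constructor
    · intro h x hx
      exact LinearMap.congr_fun h (Submodule.Quotient.mk ⟨x, hx⟩)
    · intro h
      exact Submodule.linearMap_qext _ (LinearMap.ext fun x => h x.1 x.2)
  rw [h1, ← LinearMap.range_dualMap_eq_dualAnnihilator_ker]
  rfl

/-- Both `E` and `F` are the quotient of `Z` by the same kernel. As `Z` is only an additive monoid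
by assumption, differences in it are formed with the scalar `-1`. -/
lemma nonempty_equiv_of_surjective {Z E F : Type*} [AddCommMonoid Z] [Module k Z]
    [AddCommGroup E] [Module k E] [AddCommGroup F] [Module k F] {Θ : Z →ₗ[k] E} {Ψ : Z →ₗ[k] F}
    (hΘ : Function.Surjective Θ) (hΨ : Function.Surjective Ψ) (h : ∀ z, Θ z = 0 ↔ Ψ z = 0) :
    Nonempty (E ≃ₗ[k] F) := by
  have key : ∀ y z, Θ y = Θ z ↔ Ψ y = Ψ z := fun y z => by
    have := h (y + (-1 : k) • z)
    simpa [← sub_eq_add_neg, sub_eq_zero] using this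
  let g := Function.surjInv hΘ
  have hg : ∀ z, Ψ (g (Θ z)) = Ψ z := fun z => (key _ _).mp (Function.surjInv_eq hΘ _)
  let T : E →ₗ[k] F :=
    { toFun := fun x => Ψ (g x)
      map_add' := fun x y => by
        obtain ⟨x, rfl⟩ := hΘ x
        obtain ⟨y, rfl⟩ := hΘ y
        rw [← map_add, hg, hg, hg, map_add]
      map_smul' := fun r x => by
        obtain ⟨x, rfl⟩ := hΘ x
        rw [← map_smul, hg, hg, map_smul, RingHom.id_apply] }
  refine ⟨LinearEquiv.ofBijective T ⟨fun x y hxy => ?_, fun y => ?_⟩⟩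
  · obtain ⟨x, rfl⟩ := hΘ x
    obtain ⟨y, rfl⟩ := hΘ y
    exact (key _ _).mpr (by rw [← hg x, ← hg y]; exact hxy)
  · obtain ⟨z, rfl⟩ := hΨ y
    exact ⟨Θ z, hg z⟩

/-- A space that is presented as the functionals vanishing on boundaries, modulo those that factor
through the outgoing differential, is the dual of homology. -/
lemma nonempty_equiv_dual_homology {E : Type*} [AddCommGroup E] [Module k E]
    (Θ : dualCocycles S →ₗ[k] E) (hΘ : Function.Surjective Θ)
    (hker : ∀ φ, Θ φ = 0 ↔ ∃ ψ : Module.Dual k S.X₃, ψ ∘ₗ S.g.hom = φ.1) :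
    Nonempty (E ≃ₗ[k] Module.Dual k S.homology) := by
  let i : S.homology ≃ₗ[k] (LinearMap.ker S.g.hom ⧸ LinearMap.range S.moduleCatToCycles) :=
    S.moduleCatHomologyIso.toLinearEquiv
  let Ψ : dualCocycles S →ₗ[k] Module.Dual k S.homology :=
    i.dualMap.toLinearMap ∘ₗ dualCocyclesToDual S
  have hΨ : Function.Surjective Ψ :=
    i.dualMap.surjective.comp (dualCocyclesToDual_surjective S)
  refine nonempty_equiv_of_surjective hΘ hΨ fun φ => ?_
  rw [hker, ← dualCocyclesToDual_eq_zero_iff]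
  exact (map_eq_zero_iff _ i.dualMap.injective).symm

end DualHomology

/-! ### Duality between `Ext` and `Tor`. -/

section ExtMk

open Abelian CategoryTheory.ProjectiveResolution

variable {𝒞 : Type*} [Category* 𝒞] [Abelian 𝒞] [HasExt.{u} 𝒞] {X Y : 𝒞}
  (P : ProjectiveResolution X)

/-- In degree `0` there are no nonzero coboundaries: they would factor through cochain degree `1`,
where the resolution is zero. -/
lemma extMk_zero_eq_zero_iff (f : P.complex.X 0 ⟶ Y) (hf : P.complex.d 1 0 ≫ f = 0) :
    P.extMk f 1 rfl hf = 0 ↔ f = 0 := by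
  refine ⟨fun h => ?_, fun h => by subst h; simp⟩
  simp only [← P.extEquivCohomologyClass.apply_eq_iff_eq,
    extEquivCohomologyClass_extMk, extEquivCohomologyClass_zero,
    CochainComplex.HomComplex.CohomologyClass.mk_eq_zero_iff] at h
  rw [CochainComplex.HomComplex.Cocycle.toSingleMk_mem_coboundaries_iff _ _ _ _ _ 1 (by simp)] at h
  obtain ⟨g, hg⟩ := h
  have h0 : Limits.IsZero (P.cochainComplex.X 1) :=
    P.cochainComplex.isZero_of_isStrictlyLE 0 1 (by lia)
  rw [h0.eq_of_src g 0, Limits.comp_zero] at hg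
  rw [← cancel_epi (P.cochainComplexXIso (-(0 : ℕ)) 0 rfl).hom, Limits.comp_zero]
  exact hg.symm

lemma smul_extMk {k : Type*} [Ring k] [Linear k 𝒞] {n : ℕ} (r : k) (f : P.complex.X n ⟶ Y)
    (m : ℕ) (hm : n + 1 = m) (hf : P.complex.d m n ≫ f = 0) :
    r • P.extMk f m hm hf = P.extMk (r • f) m hm (by rw [Linear.comp_smul, hf, smul_zero]) := by
  rw [Ext.smul_eq_comp_mk₀, extMk_comp_mk₀]
  simp

end ExtMk

section TensorDual

open ModuleCat

variable {k : Type w} [Field k] {A : Type u} [Ring A] [Algebra k A]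
  {N : Type u} [AddCommGroup N] [Module k N] [Module A N] [IsScalarTower k A N]
  {Y : ModuleCat.{u} Aᵐᵒᵖ} (D : Y ≃ₗ[k] Module.Dual k N)
  (hD : ∀ (a : A) (y : Y) (x : N), D (op a • y) x = D y (a • x))

/-- The adjunction `Hom_A(X, DN) ≃ D(X ⊗_A N)`, for a right module `Y` that is identified with the
dual `DN` of `N`. -/
def homEquivDualBalanced (X : ModuleCat.{u} Aᵐᵒᵖ) :
    (X ⟶ Y) ≃ₗ[k] Module.Dual k (BalancedTensor k A X N) where
  toFun f := Submodule.liftQ _ (TensorProduct.lift (D.toLinearMap ∘ₗ homRestrict k X Y f)) <| by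
    rw [balancedRel, Submodule.span_le]
    rintro _ ⟨m, a, x, rfl⟩
    have : D (f.hom (op a • m)) x = D (f.hom m) (a • x) := by rw [map_smul, hD]
    rw [SetLike.mem_coe, LinearMap.mem_ker, map_sub, sub_eq_zero]
    exact this
  map_add' f g := balanced_hom_ext k A fun m x => by
    change D ((f + g).hom m) x = D (f.hom m) x + D (g.hom m) x
    rw [ModuleCat.hom_add, LinearMap.add_apply, map_add, LinearMap.add_apply]
  map_smul' r f := balanced_hom_ext k A fun m x => by
    change D (r • f.hom m) x = r • D (f.hom m) x
    rw [map_smul, LinearMap.smul_apply]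
  invFun φ := ModuleCat.ofHom
    { toFun := fun m => D.symm (φ ∘ₗ (balancedRel k A X N).mkQ ∘ₗ TensorProduct.mk k X N m)
      map_add' := fun m m' => by
        rw [← map_add]
        congr 1
        ext x
        simp
      map_smul' := fun a m => by
        rw [RingHom.id_apply, LinearEquiv.symm_apply_eq]
        ext x
        rw [← op_unop a, hD, LinearEquiv.apply_symm_apply]
        change φ (Submodule.Quotient.mk _) = φ (Submodule.Quotient.mk _)
        congr 1
        exact (Submodule.Quotient.eq _).mpr (Submodule.subset_span ⟨m, unop a, x, rfl⟩) }
  left_inv f := by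
    ext m
    change D.symm _ = f.hom m
    rw [LinearEquiv.symm_apply_eq]
    rfl
  right_inv φ := balanced_hom_ext k A fun m x => by
    change D (D.symm _) x = _
    rw [LinearEquiv.apply_symm_apply]
    rfl

/-- The adjunction `homEquivDualBalanced`, stated for the functor `- ⊗_A N`. -/
def homEquivDualTensor (X : ModuleCat.{u} Aᵐᵒᵖ) :
    (X ⟶ Y) ≃ₗ[k] Module.Dual k ((tensorFunctor k A N).obj X) :=
  homEquivDualBalanced D hD X

lemma homEquivDualTensor_comp {X X' : ModuleCat.{u} Aᵐᵒᵖ} (h : X' ⟶ X) (f : X ⟶ Y) :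
    homEquivDualTensor D hD X' (h ≫ f) =
      homEquivDualTensor D hD X f ∘ₗ ((tensorFunctor k A N).map h).hom :=
  balanced_hom_ext k A fun _ _ => rfl

lemma homEquivDualTensor_symm_comp {X X' : ModuleCat.{u} Aᵐᵒᵖ} (h : X' ⟶ X)
    (φ : Module.Dual k ((tensorFunctor k A N).obj X)) :
    (homEquivDualTensor D hD X').symm (φ ∘ₗ ((tensorFunctor k A N).map h).hom) =
      h ≫ (homEquivDualTensor D hD X).symm φ := by
  rw [LinearEquiv.symm_apply_eq, homEquivDualTensor_comp, LinearEquiv.apply_symm_apply]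

/-- Under the adjunction, coboundaries become the functionals that factor through the outgoing
differential. At `l = 0` that differential is zero, so the condition says that `f = 0`. -/
lemma extMk_eq_zero_iff_exists_dual {X : ModuleCat.{u} Aᵐᵒᵖ} (P : ProjectiveResolution X)
    {l q : ℕ} (hq : (ComplexShape.down ℕ).next l = q) (f : P.complex.X l ⟶ Y)
    (hf : P.complex.d (l + 1) l ≫ f = 0) :
    P.extMk f (l + 1) rfl hf = 0 ↔
      ∃ ψ : Module.Dual k ((tensorFunctor k A N).obj (P.complex.X q)),
        ψ ∘ₗ ((tensorFunctor k A N).map (P.complex.d l q)).hom =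
          homEquivDualTensor D hD (P.complex.X l) f := by
  cases l with
  | zero =>
    have h0 : P.complex.d 0 q = 0 := P.complex.shape _ _ (by simp)
    rw [h0, Functor.map_zero, extMk_zero_eq_zero_iff]
    constructor
    · rintro rfl
      exact ⟨0, by rw [LinearMap.zero_comp, map_zero]⟩
    · rintro ⟨ψ, hψ⟩
      apply (homEquivDualTensor D hD (P.complex.X 0)).injective
      rw [← hψ, map_zero]
      exact LinearMap.comp_zero ψ
  | succ l =>
    obtain rfl : l = q := by rw [← hq, ChainComplex.next_nat_succ]
    rw [P.extMk_eq_zero_iff f _ rfl hf l rfl]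
    constructor
    · rintro ⟨g, rfl⟩
      exact ⟨homEquivDualTensor D hD _ g, (homEquivDualTensor_comp D hD _ g).symm⟩
    · rintro ⟨ψ, hψ⟩
      refine ⟨(homEquivDualTensor D hD _).symm ψ, ?_⟩
      rw [← homEquivDualTensor_symm_comp, hψ, LinearEquiv.symm_apply_apply]

open Abelian in
/-- `Ext` with values in the dual of `N` is dual to `Tor` with coefficients in `N`. -/
lemma nonempty_ext_equiv_dual_tor {Y : ModuleCat.{u} Aᵐᵒᵖ} (D : Y ≃ₗ[k] Module.Dual k N)
    (hD : ∀ (a : A) (y : Y) (x : N), D (op a • y) x = D y (a • x)) (X : ModuleCat.{u} Aᵐᵒᵖ)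
    (l : ℕ) :
    Nonempty (Ext X Y l ≃ₗ[k] Module.Dual k (((tensorFunctor k A N).leftDerived l).obj X)) := by
  let P := projectiveResolution X
  let K := ((tensorFunctor k A N).mapHomologicalComplex (ComplexShape.down ℕ)).obj P.complex
  let q := (ComplexShape.down ℕ).next l
  let S := K.sc' (l + 1) l q
  let β := homEquivDualTensor D hD (P.complex.X l)
  -- By naturality of the adjunction, functionals on `Pₗ ⊗ N` vanishing on boundaries correspond to
  -- cocycles `Pₗ → Y`, and each of these represents a class in `Ext X Y l`.
  have hcoc : ∀ φ : dualCocycles S, P.complex.d (l + 1) l ≫ β.symm φ.1 = 0 := fun φ => by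
    have := homEquivDualTensor_symm_comp D hD (P.complex.d (l + 1) l) φ.1
    rw [← this]
    refine (congrArg _ (LinearMap.mem_ker.mp φ.2)).trans (map_zero _)
  let Θ : dualCocycles S →ₗ[k] Ext X Y l :=
    { toFun := fun φ => P.extMk (β.symm φ.1) (l + 1) rfl (hcoc φ)
      map_add' := fun φ ψ => by
        rw [ProjectiveResolution.add_extMk]
        congr 1
        exact map_add β.symm φ.1 ψ.1
      map_smul' := fun r φ => by
        rw [RingHom.id_apply, smul_extMk]
        congr 1
        exact map_smul β.symm r φ.1 }
  have hΘ : Function.Surjective Θ := fun x => by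
    obtain ⟨f, hf, rfl⟩ := P.extMk_surjective x (l + 1) rfl
    refine ⟨⟨β f, ?_⟩, ?_⟩
    · have := homEquivDualTensor_comp D hD (P.complex.d (l + 1) l) f
      rw [hf, map_zero] at this
      exact this.symm
    · have hcongr : ∀ (g : P.complex.X l ⟶ Y) (hg : P.complex.d (l + 1) l ≫ g = 0), g = f →
          P.extMk g (l + 1) rfl hg = P.extMk f (l + 1) rfl hf := by
        rintro _ _ rfl
        rfl
      exact hcongr _ (hcoc ⟨β f, _⟩) (β.symm_apply_apply f)
  have hker : ∀ φ, Θ φ = 0 ↔ ∃ ψ : Module.Dual k S.X₃, ψ ∘ₗ S.g.hom = φ.1 := by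
    intro φ
    refine (extMk_eq_zero_iff_exists_dual D hD P rfl (β.symm φ.1) (hcoc φ)).trans ?_
    rw [show homEquivDualTensor D hD _ (β.symm φ.1) = φ.1 from β.apply_symm_apply φ.1]
    rfl
  obtain ⟨E⟩ := nonempty_equiv_dual_homology S Θ hΘ hker
  have i : ((tensorFunctor k A N).leftDerived l).obj X ≅ S.homology :=
    P.isoLeftDerivedObj (tensorFunctor k A N) l ≪≫
      ShortComplex.homologyMapIso (K.isoSc' (l + 1) l q (ChainComplex.prev ℕ l) rfl)
  exact ⟨E ≪≫ₗ i.toLinearEquiv.dualMap⟩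

end TensorDual

section DualModule

open ModuleCat

variable (k : Type w) [Field k] (A : Type u) [Ring A] [Algebra k A]
  (N : Type u) [AddCommGroup N] [Module k N] [Module A N] [IsScalarTower k A N]

/-- The `k`-structure of `Y` is the one induced by `Aᵐᵒᵖ`, so `k`-linearity of `ψ` is `hψ` applied
to the scalars in `A`. -/
lemma exists_linearEquiv_dual (Y : ModuleCat.{u} Aᵐᵒᵖ)
    (ψ : Y ≃+ Module.Dual k N) (hψ : ∀ (a : A) (y : Y) (x : N), ψ (op a • y) x = ψ y (a • x)) :
    ∃ D : Y ≃ₗ[k] Module.Dual k N,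
      ∀ (a : A) (y : Y) (x : N), D (op a • y) x = D y (a • x) := by
  refine ⟨{ ψ with map_smul' := fun r y => LinearMap.ext fun x => ?_ }, hψ⟩
  refine (hψ (algebraMap k A r) y x).trans ?_
  rw [algebraMap_smul, map_smul]
  rfl

/-- The dual of a finite-dimensional left module is isomorphic to a right module in the same
universe. -/
lemma exists_dual_module [FiniteDimensional k N] :
    ∃ (Y : ModuleCat.{u} Aᵐᵒᵖ) (D : Y ≃ₗ[k] Module.Dual k N),
      ∀ (a : A) (y : Y) (x : N), D (op a • y) x = D y (a • x) := by
  -- `Module.Dual k N` may live in a larger universe than `N`. A noncanonical isomorphism, available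
  -- in finite dimension, moves the dual action onto the underlying space of `N`.
  let ψ : N ≃ₗ[k] Module.Dual k N :=
    LinearEquiv.ofFinrankEq _ _ Subspace.dual_finrank_eq.symm
  let τ (a : Aᵐᵒᵖ) : Module.End k N :=
    ψ.symm.toLinearMap ∘ₗ (Algebra.lsmul k k N (unop a)).dualMap ∘ₗ ψ.toLinearMap
  have hτ : ∀ (a : Aᵐᵒᵖ) (y x : N), ψ (τ a y) x = ψ y (unop a • x) := fun a y x => by
    change ψ (ψ.symm _) x = _
    rw [LinearEquiv.apply_symm_apply]
    rfl
  let ρ : Aᵐᵒᵖ →+* Module.End k N :=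
    { toFun := τ
      map_one' := LinearMap.ext fun y => ψ.injective <| LinearMap.ext fun x => by simp [hτ]
      map_mul' := fun a b => LinearMap.ext fun y => ψ.injective <| LinearMap.ext fun x => by
        simp [hτ, mul_smul]
      map_zero' := LinearMap.ext fun y => ψ.injective <| LinearMap.ext fun x => by simp [hτ]
      map_add' := fun a b => LinearMap.ext fun y => ψ.injective <| LinearMap.ext fun x => by
        simp [hτ, add_smul] }
  let : Module Aᵐᵒᵖ N := Module.compHom N ρ
  exact ⟨ModuleCat.of Aᵐᵒᵖ N,
    exists_linearEquiv_dual k A N _ ψ.toAddEquiv fun a y x => hτ (op a) y x⟩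

variable {k A N}

lemma peirceDim_of_equiv_dual {Y : ModuleCat.{u} Aᵐᵒᵖ} (D : Y ≃ₗ[k] Module.Dual k N)
    (hD : ∀ (a : A) (y : Y) (x : N), D (op a • y) x = D y (a • x)) [FiniteDimensional k N]
    (a : A) : peirceDim k (op a) Y = peirceDim k a N := by
  rw [peirceDim, peirceDim,
    ← LinearMap.finrank_range_dualMap_eq_finrank_range (Algebra.lsmul k k N a),
    ← finrank_range_comp_comp k (ι := D.toLinearMap) (π := D.symm.toLinearMap) _ D.injective
      D.symm.surjective]
  have h : D.toLinearMap ∘ₗ Algebra.lsmul k k Y (op a) ∘ₗ D.symm.toLinearMap =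
      (Algebra.lsmul k k N a).dualMap := by
    ext φ x
    change D (op a • D.symm φ) x = φ (a • x)
    rw [hD, LinearEquiv.apply_symm_apply]
  rw [h]

/-- There is a right module `Y` such that `Tor` with coefficients in `N` has the same dimensions as
`Ext` with values in `Y`. -/
lemma exists_finrank_tor_eq_finrank_ext [FiniteDimensional k A] [FiniteDimensional k N] :
    ∃ (Y : ModuleCat.{u} Aᵐᵒᵖ), Module.Finite Aᵐᵒᵖ Y ∧
      (∀ a : A, peirceDim k (op a) Y = peirceDim k a N) ∧
      ∀ (X : ModuleCat.{u} Aᵐᵒᵖ) [Module.Finite Aᵐᵒᵖ X] (l : ℕ),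
        FiniteDimensional k (((tensorFunctor k A N).leftDerived l).obj X) ∧
        Module.finrank k (((tensorFunctor k A N).leftDerived l).obj X) =
          Module.finrank k (Abelian.Ext X Y l) := by
  obtain ⟨Y, D, hD⟩ := exists_dual_module k A N
  have : FiniteDimensional k Y := Module.Finite.equiv D.symm
  have hY : Module.Finite Aᵐᵒᵖ Y := Module.Finite.of_restrictScalars_finite k Aᵐᵒᵖ Y
  have : FiniteDimensional k Aᵐᵒᵖ := Module.Finite.equiv (MulOpposite.opLinearEquiv k)
  refine ⟨Y, hY, peirceDim_of_equiv_dual D hD, fun X _ l => ?_⟩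
  obtain ⟨E⟩ := nonempty_ext_equiv_dual_tor D hD X l
  have := finiteDimensional_ext k X Y l
  have : FiniteDimensional k (Module.Dual k (((tensorFunctor k A N).leftDerived l).obj X)) :=
    Module.Finite.equiv E
  have hfin := Module.finite_dual_iff k |>.mp this
  exact ⟨hfin, by rw [E.finrank_eq, Subspace.dual_finrank_eq]⟩

end DualModule

/-! ### Corners of `Tor`, and truncation of the alternating sums. -/

section TorCorner

open ModuleCat

variable (k : Type w) [Field k] (A : Type u) [Ring A] [Algebra k A]
  {N N' N'' : Type u} [AddCommGroup N] [Module k N] [Module A N] [IsScalarTower k A N]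
  [AddCommGroup N'] [Module k N'] [Module A N'] [IsScalarTower k A N']
  [AddCommGroup N''] [Module k N''] [Module A N''] [IsScalarTower k A N'']

/-- The natural transformation `- ⊗_A h` for a homomorphism `h : N → N'`. -/
def tensorNatTransHom (h : N →ₗ[A] N') : tensorFunctor k A N ⟶ tensorFunctor k A N' where
  app X := ModuleCat.ofHom (balancedMap k A (LinearMap.id : X →ₗ[Aᵐᵒᵖ] X) h)
  naturality X Y f := by
    change ModuleCat.ofHom _ ≫ ModuleCat.ofHom _ = ModuleCat.ofHom _ ≫ ModuleCat.ofHom _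
    rw [← ModuleCat.ofHom_comp, ← ModuleCat.ofHom_comp, ← balancedMap_comp, ← balancedMap_comp]

lemma tensorNatTransHom_comp (h : N →ₗ[A] N') (h' : N' →ₗ[A] N'') :
    tensorNatTransHom k A h ≫ tensorNatTransHom k A h' = tensorNatTransHom k A (h' ∘ₗ h) :=
  NatTrans.ext (funext fun _ => ModuleCat.hom_ext
    (balancedMap_comp k A LinearMap.id LinearMap.id h h').symm)

variable (N) in
lemma tensorNatTransHom_id : tensorNatTransHom k A (LinearMap.id : N →ₗ[A] N) = 𝟙 _ :=
  tensorNatTrans_id k A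

variable (B : Type w₁) [Ring B] [Algebra k B] (C : Type w₂) [Ring C] [Algebra k C]
  (M : Type u) [AddCommGroup M] [Module k M] [Module Aᵐᵒᵖ M] [IsScalarTower k Aᵐᵒᵖ M]
  [Module B M] [IsScalarTower k B M] [SMulCommClass B Aᵐᵒᵖ M]
  (N) [Module Cᵐᵒᵖ N] [IsScalarTower k Cᵐᵒᵖ N] [SMulCommClass A Cᵐᵒᵖ N]
  [SMulCommClass Cᵐᵒᵖ A N] (l : ℕ)

/-- The retract argument of `finrank_corner_extBimod`: `f` splits through the functor in `M`, `g`
through natural transformations of derived functors, and naturality lets the two splittings be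
combined. -/
lemma finrank_corner_torBimod {f : B} {g : C} (hf : IsIdempotentElem f)
    (hg : IsIdempotentElem g) :
    Module.finrank k (corner k g f (TorBimod k A B C M N l)) =
      Module.finrank k (((tensorFunctor k A (peirceSummand A (op g) N)).leftDerived l).obj
        (ModuleCat.of Aᵐᵒᵖ (peirceSummand Aᵐᵒᵖ f M))) := by
  let iM := ModuleCat.ofHom (peirceIncl Aᵐᵒᵖ f M)
  let pM := ModuleCat.ofHom (peirceProj Aᵐᵒᵖ f M)
  let iN := NatTrans.leftDerived (tensorNatTransHom k A (peirceIncl A (op g) N)) l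
  let pN := NatTrans.leftDerived (tensorNatTransHom k A (peirceProj A (op g) N)) l
  let F := (tensorFunctor k A N).leftDerived l
  let F' := (tensorFunctor k A (peirceSummand A (op g) N)).leftDerived l
  have hg' : IsIdempotentElem (op g) := congrArg op hg
  have hM : iM ≫ pM = 𝟙 _ := ModuleCat.hom_ext (peirceProj_comp_peirceIncl Aᵐᵒᵖ M hf)
  have hN : iN ≫ pN = 𝟙 _ := by
    rw [← NatTrans.leftDerived_comp, tensorNatTransHom_comp,
      peirceProj_comp_peirceIncl A N hg', tensorNatTransHom_id, NatTrans.leftDerived_id]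
  have hN' : pN ≫ iN = NatTrans.leftDerived
      (tensorNatTrans k A (Module.toModuleEnd A (S := Cᵐᵒᵖ) N (op g))) l := by
    rw [← NatTrans.leftDerived_comp, tensorNatTransHom_comp, peirceIncl_comp_peirceProj]
    rfl
  let ι := F'.map iM ≫ iN.app (ModuleCat.of Aᵐᵒᵖ M)
  let π := pN.app (ModuleCat.of Aᵐᵒᵖ M) ≫ F'.map pM
  have hιπ : ι ≫ π = 𝟙 _ := by
    have h1 : iN.app (ModuleCat.of Aᵐᵒᵖ M) ≫ pN.app (ModuleCat.of Aᵐᵒᵖ M) = 𝟙 _ := by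
      rw [← NatTrans.comp_app, hN, NatTrans.id_app]
    simp only [ι, π, Category.assoc]
    rw [← Category.assoc (iN.app _), h1, Category.id_comp, ← Functor.map_comp, hM,
      CategoryTheory.Functor.map_id]
  have hπι : π ≫ ι = (pN ≫ iN).app (ModuleCat.of Aᵐᵒᵖ M) ≫ F.map (pM ≫ iM) := by
    simp only [ι, π, Category.assoc, NatTrans.comp_app]
    rw [← Functor.map_comp_assoc, iN.naturality]
  have hcorner : corner k g f (TorBimod k A B C M N l) =
      LinearMap.range (ι.hom ∘ₗ LinearMap.id ∘ₗ π.hom) := by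
    have h2 := congrArg ModuleCat.Hom.hom hπι
    rw [hN'] at h2
    exact congrArg LinearMap.range h2.symm
  have hid : π.hom ∘ₗ ι.hom = LinearMap.id := congrArg ModuleCat.Hom.hom hιπ
  refine (congrArg (fun V : Submodule k (F.obj (ModuleCat.of Aᵐᵒᵖ M)) => Module.finrank k V)
    hcorner).trans ?_
  refine (finrank_range_comp_comp k LinearMap.id
    (LinearMap.injective_of_comp_eq_id _ _ hid)
    (LinearMap.surjective_of_comp_eq_id _ _ hid)).trans ?_
  rw [LinearMap.range_id, finrank_top]

end TorCorner

section SuperDim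

variable (k : Type w) [Field k] {A : Type w₁} [Ring A] [Algebra k A]
  {B : Type w₂} [Ring B] [Algebra k B]

lemma superDimMatrix_apply {n m : ℕ} (e : Fin n → A) (f : Fin m → B) (H : ℕ → Type*)
    [∀ l, AddCommGroup (H l)] [∀ l, Module k (H l)] [∀ l, Module B (H l)]
    [∀ l, Module Aᵐᵒᵖ (H l)] [∀ l, IsScalarTower k B (H l)]
    [∀ l, IsScalarTower k Aᵐᵒᵖ (H l)] {D : ℕ} (hD : ∀ l, D ≤ l → Subsingleton (H l))
    (i : Fin n) (j : Fin m) :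
    superDimMatrix k e f H i j =
      ∑ l ∈ Finset.range D, (-1) ^ l * (Module.finrank k (corner k (e i) (f j) (H l)) : ℤ) := by
  have hsupp : (Function.support fun l : ℕ => (-1 : ℤ) ^ l • dimMatrix k e f (H l)) ⊆
      (Finset.range D : Finset ℕ) := by
    intro l hl
    by_contra hlD
    have := hD l (by simpa using hlD)
    apply hl
    ext i j
    simp [dimMatrix, Module.finrank_zero_of_subsingleton]
  rw [superDimMatrix, finsum_eq_sum_of_support_subset _ hsupp, Matrix.sum_apply]
  simp [dimMatrix]

lemma isTotallyFinite_of_subsingleton (H : ℕ → Type*) [∀ l, AddCommGroup (H l)]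
    [∀ l, Module k (H l)] (hfin : ∀ l, FiniteDimensional k (H l)) {D : ℕ}
    (hD : ∀ l, D ≤ l → Subsingleton (H l)) : IsTotallyFinite k H := by
  refine ⟨hfin, (Set.finite_lt_nat D).subset fun l hl => ?_⟩
  by_contra h
  have := hD l (not_lt.mp h)
  exact not_nontrivial (H l) hl

end SuperDim

end HRR

end

/-! ### Assembly of the two formulas. -/

theorem theorem2 {k : Type w} [Field k]
    {A : Type u} [Ring A] [Algebra k A] [FiniteDimensional k A]
    {B : Type w₁} [Ring B] [Algebra k B] [FiniteDimensional k B]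
    {C : Type w₂} [Ring C] [Algebra k C] [FiniteDimensional k C]
    (hA : HRR.IsElementary k A) (hB : HRR.IsElementary k B) (hC : HRR.IsElementary k C)
    (hdim : HRR.HasFiniteGlobalDimension A)
    {n m p : ℕ} (e : Fin n → A) (f : Fin m → B) (g : Fin p → C)
    (he : HRR.IsCompletePrimitive e) (hf : HRR.IsCompletePrimitive f)
    (hg : HRR.IsCompletePrimitive g) :
    IsUnit (HRR.cartanMatrix k e) ∧
    -- `M` is a `B`-`A`-bimodule and `N` is a `C`-`A`-bimodule
    (∀ (M N : Type u)
      [AddCommGroup M] [Module k M] [FiniteDimensional k M] [Module B M] [Module Aᵐᵒᵖ M]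
      [IsScalarTower k B M] [IsScalarTower k Aᵐᵒᵖ M] [SMulCommClass B Aᵐᵒᵖ M]
      [AddCommGroup N] [Module k N] [FiniteDimensional k N] [Module C N] [Module Aᵐᵒᵖ N]
      [IsScalarTower k C N] [IsScalarTower k Aᵐᵒᵖ N] [SMulCommClass C Aᵐᵒᵖ N],
      HRR.IsTotallyFinite k (HRR.ExtBimod k A B C M N) ∧
      HRR.superDimMatrix k f g (HRR.ExtBimod k A B C M N) =
        (HRR.dimMatrix k e f M).transpose * (HRR.cartanMatrix k e)⁻¹.transpose *
          HRR.dimMatrix k e g N) ∧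
    -- `M` is a `B`-`A`-bimodule and `N` is an `A`-`C`-bimodule
    (∀ (M N : Type u)
      [AddCommGroup M] [Module k M] [FiniteDimensional k M] [Module B M] [Module Aᵐᵒᵖ M]
      [IsScalarTower k B M] [IsScalarTower k Aᵐᵒᵖ M] [SMulCommClass B Aᵐᵒᵖ M]
      [AddCommGroup N] [Module k N] [FiniteDimensional k N] [Module A N] [Module Cᵐᵒᵖ N]
      [IsScalarTower k A N] [IsScalarTower k Cᵐᵒᵖ N] [SMulCommClass A Cᵐᵒᵖ N],
      HRR.IsTotallyFinite k (HRR.TorBimod k A B C M N) ∧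
      HRR.superDimMatrix k g f (HRR.TorBimod k A B C M N) =
        HRR.dimMatrix k g e N * (HRR.cartanMatrix k e)⁻¹ * HRR.dimMatrix k e f M) := by
  obtain ⟨c, hc, hnil⟩ := HRR.exists_characters hA he
  obtain ⟨d, hd⟩ := hdim
  have : FiniteDimensional k Aᵐᵒᵖ := Module.Finite.equiv (MulOpposite.opLinearEquiv k)
  have hNoeth : IsNoetherianRing Aᵐᵒᵖ := isNoetherian_of_tower k inferInstance
  -- Characters have commutative target, so they are also characters of the opposite algebra.
  let c' (i : Fin n) : Aᵐᵒᵖ →ₐ[k] k := (c i).fromOpposite fun _ _ => Commute.all _ _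
  have hε : CompleteOrthogonalIdempotents fun i => op (e i) :=
    { idem := fun i => congrArg op (he.idem i)
      ortho := fun i j hij => congrArg op (he.ortho hij.symm)
      complete := by simpa using congrArg op he.complete }
  obtain ⟨hunit, heuler⟩ := HRR.extEuler_eq_sum (c := c') hε (fun i j => hc i j)
    (fun x hx => (hnil (unop x) hx).imp fun m hm => unop_injective hm) hd
    (HRR.cartanMatrix k e) (HRR.cartanMatrix_apply k e)
  refine ⟨hunit, ?_, ?_⟩
  · intro M N _ _ _ _ _ _ _ _ _ _ _ _ _ _ _ _
    have : Module.Finite Aᵐᵒᵖ M := Module.Finite.of_restrictScalars_finite k Aᵐᵒᵖ M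
    have : Module.Finite Aᵐᵒᵖ N := Module.Finite.of_restrictScalars_finite k Aᵐᵒᵖ N
    have hvan : ∀ l, d + 1 ≤ l → Subsingleton (HRR.ExtBimod k A B C M N l) := fun l hl =>
      have := hd (ModuleCat.of Aᵐᵒᵖ M)
      HasProjectiveDimensionLT.subsingleton (ModuleCat.of Aᵐᵒᵖ M) (d + 1) l hl _
    refine ⟨HRR.isTotallyFinite_of_subsingleton k _
      (HRR.finiteDimensional_ext k (ModuleCat.of Aᵐᵒᵖ M) (ModuleCat.of Aᵐᵒᵖ N)) hvan, ?_⟩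
    ext i j
    rw [HRR.superDimMatrix_apply k f g _ hvan]
    simp_rw [HRR.finrank_corner_extBimod k A B C M N _ (hf.idem i) (hg.idem j)]
    refine (heuler (HRR.peirceSummand Aᵐᵒᵖ (f i) M) (HRR.peirceSummand Aᵐᵒᵖ (g j) N)).trans ?_
    simp_rw [← HRR.finrank_corner_eq_peirceDim_right, Matrix.mul_apply, Finset.sum_mul,
      Matrix.transpose_apply, HRR.dimMatrix, Matrix.of_apply]
    exact Finset.sum_comm
  · intro M N _ _ _ _ _ _ _ _ _ _ _ _ _ _ _ _
    have := SMulCommClass.symm A Cᵐᵒᵖ N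
    have : Module.Finite Aᵐᵒᵖ M := Module.Finite.of_restrictScalars_finite k Aᵐᵒᵖ M
    -- The dual of all of `N` serves for finiteness and vanishing of `Tor`.
    obtain ⟨Y, hYfin, -, hY⟩ := HRR.exists_finrank_tor_eq_finrank_ext (k := k) (A := A) (N := N)
    have hvan : ∀ l, d + 1 ≤ l → Subsingleton (HRR.TorBimod k A B C M N l) := fun l hl => by
      have := hd (ModuleCat.of Aᵐᵒᵖ M)
      have := HasProjectiveDimensionLT.subsingleton (ModuleCat.of Aᵐᵒᵖ M) (d + 1) l hl Y
      obtain ⟨h1, h2⟩ := hY (ModuleCat.of Aᵐᵒᵖ M) l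
      exact (Module.finrank_zero_iff (R := k)
        (M := HRR.torObj k A M N l)).mp (h2.trans Module.finrank_zero_of_subsingleton)
    refine ⟨HRR.isTotallyFinite_of_subsingleton k _
      (fun l => (hY (ModuleCat.of Aᵐᵒᵖ M) l).1) hvan, ?_⟩
    ext i j
    have : FiniteDimensional k (HRR.peirceSummand A (op (g i)) N) :=
      Module.Finite.of_injective ((HRR.peirceIncl A (op (g i)) N).restrictScalars k)
        Subtype.val_injective
    -- For the entry `(i, j)` the dual of the summand `Ngᵢ` is used; its Peirce dimensions are the
    -- numbers `dim eₐNgᵢ`.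
    obtain ⟨Z, hZfin, hZdim, hZ⟩ := HRR.exists_finrank_tor_eq_finrank_ext (k := k) (A := A)
      (N := HRR.peirceSummand A (op (g i)) N)
    rw [HRR.superDimMatrix_apply k g f _ hvan]
    simp_rw [HRR.finrank_corner_torBimod k A N B C M _ (hf.idem j) (hg.idem i)]
    simp_rw [fun l => (hZ (ModuleCat.of Aᵐᵒᵖ (HRR.peirceSummand Aᵐᵒᵖ (f j) M)) l).2]
    let := ModuleCat.moduleOfAlgebraModule (k := k) Z
    have := ModuleCat.isScalarTower_of_algebra_moduleCat (k := k) Z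
    refine (heuler (HRR.peirceSummand Aᵐᵒᵖ (f j) M) Z).trans ?_
    have hZdim' : ∀ a, HRR.peirceDim k (op (e a)) Z =
        Module.finrank k (HRR.corner k (g i) (e a) N) := fun a =>
      (hZdim (e a)).trans (HRR.finrank_corner_eq_peirceDim_left k (g i) (e a) N).symm
    simp_rw [hZdim', ← HRR.finrank_corner_eq_peirceDim_right, Matrix.mul_apply, Finset.sum_mul,
      HRR.dimMatrix, Matrix.of_apply]
    refine Finset.sum_congr rfl fun a _ => Finset.sum_congr rfl fun b _ => ?_
    ring
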